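/- Let $\Sigma$ be a closed surface with a finite cell decomposition, i.e. $\Sigma$ is obtained from finitely many polygons (each with at least one side) by gluing their sides in pairs; $\Sigma$ need be neither orientable nor connected, and two sides of the same polygon may be glued to each other. Let $E$ and $F$ be the sets of edges and faces, and for $X\subseteq F$ let $E(X)\subseteq E$ be the set of edges contained in at least one face of $X$. Let $D:E\to(0,\pi)$ and $\Phi:F\to(0,\infty)$ be functions. A hyperbolic circle pattern on $\Sigma$ with intersection angle function $D$ consists of a radius function $r:F\to(0,\infty)$ and the following hyperbolic structure with cone points on $\Sigma$. Choose a centre $O_f$ in each face $f$. For each edge $e$ with end points $P,Q$, whose two sides belong to the faces $f,f'$ (possibly $f=f'$), the quadrilateral $O_fPO_{f'}Q$ is realized as a hyperbolic quadrilateral with side lengths $|O_fP|=|O_fQ|=r(f)$, $|O_{f'}P|=|O_{f'}Q|=r(f')$ and angles $\angle O_fPO_{f'}=\angle O_fQO_{f'}=\pi-D(e)$ (the union of two congruent triangles $O_fPO_{f'}$ and $O_fQO_{f'}$ lying on opposite sides of $O_fO_{f'}$), and all these quadrilaterals are glued isometrically along corresponding sides $O_fP$. The circle of $f$ has centre $O_f$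 and radius $r(f)$. The cone angle of the pattern at $O_f$ is $\sum 2\varphi(f,e)$, where $\varphi(f,e)=\angle PO_fO_{f'}$ and the sum runs over the sides $e$ of the polygon $f$ (an edge with $f$ on both sides contributes twice). The pattern has cone angle function $\Phi$ if its cone angle at $O_f$ is $\Phi(f)$ for every $f\in F$. No condition is imposed on the angle sums at the vertices of the decomposition. Theorem (Bobenko–Springborn, hyperbolic case). A hyperbolic circle pattern on $\Sigma$ with intersection angle function $D$ and cone angle function $\Phi$ exists if and only if $$\sum_{f\in X}\tfrac12\Phi(f)<\sum_{e\in E(X)}D(e)\qquad\text{for every nonempty } X\subseteq F.$$ Moreover it is unique up to isometry: any two hyperbolic circle patterns on $\Sigma$ with the same $D$ and $\Phi$ have the same radius function, and there is an isometry between their surfaces which respects the cell decomposition and takes the centre $O_f$ to the centre $O_f$ for each $f\in F$. -/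

import Mathlib

noncomputable section

/-! ### Closed surfaces with a cell decomposition -/

/-- A closed surface with a (finite) cell decomposition, described by its flags.

A flag is an incident triple (vertex, side, face), i.e. one triangle of the barycentric
subdivision of the decomposition.  Every flag has exactly one neighbour across each of its three
sides: `τ₀` changes the vertex only, `τ₁` changes the edge only, `τ₂` changes the face only.
The flags around the midpoint of an edge are the four flags `t, τ₀ t, τ₂ t, τ₀ (τ₂ t)`.
Faces are the orbits of `τ₀, τ₁` (polygons), edges the orbits of `τ₀, τ₂`, vertices the orbits
of `τ₁, τ₂`.  Equivalently: finitely many polygons, each with at least one side, whose sides are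
glued in pairs.  The surface may be non-orientable, and two sides of one and the same face may be
glued to each other. -/
structure CellSurface (T : Type*) where
  τ₀ : T → T
  τ₁ : T → T
  τ₂ : T → T
  τ₀_invol : ∀ t, τ₀ (τ₀ t) = t
  τ₁_invol : ∀ t, τ₁ (τ₁ t) = t
  τ₂_invol : ∀ t, τ₂ (τ₂ t) = t
  τ₀_ne : ∀ t, τ₀ t ≠ t
  τ₁_ne : ∀ t, τ₁ t ≠ t
  τ₂_ne : ∀ t, τ₂ t ≠ t
  τ₀_τ₂_comm : ∀ t, τ₀ (τ₂ t) = τ₂ (τ₀ t)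
  τ₀_τ₂_ne : ∀ t, τ₀ (τ₂ t) ≠ t

namespace CellSurface

variable {T : Type*} (S : CellSurface T)

/-- The set `F` of faces. -/
def Face : Type _ := Quot (fun s t : T => t = S.τ₀ s ∨ t = S.τ₁ s)

/-- The set `E` of edges. -/
def Edge : Type _ := Quot (fun s t : T => t = S.τ₀ s ∨ t = S.τ₂ s)

/-- The face of a flag. -/
def face (t : T) : S.Face := Quot.mk _ t

/-- The edge of a flag. -/
def edge (t : T) : S.Edge := Quot.mk _ t

instance [Finite T] : Finite S.Face := inferInstanceAs (Finite (Quot _))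

instance [Finite T] : Finite S.Edge := inferInstanceAs (Finite (Quot _))

instance [Finite T] : Fintype S.Face := Fintype.ofFinite _

instance [Finite T] : Fintype S.Edge := Fintype.ofFinite _

open Classical in
/-- `E(X)`: the edges contained in at least one of the faces in `X`. -/
def edgesOf [Finite T] (X : Finset S.Face) : Finset S.Edge :=
  Finset.univ.filter (fun e => ∃ t, S.edge t = e ∧ S.face t ∈ X)

end CellSurface

/-! ### Plane hyperbolic geometry, in the upper half plane with its hyperbolic distance -/

namespace HypPlane

/-- The coordinate of `z` in the Poincaré disc centred at `p`: the conformal isometry from the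
upper half plane to the Poincaré disc which takes `p` to `0`. -/
def discCoord (p z : UpperHalfPlane) : ℂ :=
  ((z : ℂ) - (p : ℂ)) / ((z : ℂ) - (starRingEnd ℂ) (p : ℂ))

/-- The hyperbolic angle `∠ a p b` at `p`.  In the Poincaré disc centred at `p` the geodesics
from `p` to `a` and to `b` are straight, and hyperbolic angles are Euclidean angles. -/
def angle (a p b : UpperHalfPlane) : ℝ :=
  InnerProductGeometry.angle (discCoord p a) (discCoord p b)

/-- The geodesic segment between two points of the hyperbolic plane. -/
def segment (a b : UpperHalfPlane) : Set UpperHalfPlane :=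
  {x | dist a x + dist x b = dist a b}

/-- The (filled) geodesic triangle with vertices `p, a, b`: the union of all segments from `p` to
points of the side `a b`. -/
def triangle (p a b : UpperHalfPlane) : Set UpperHalfPlane :=
  {x | ∃ y ∈ segment a b, x ∈ segment p y}

end HypPlane

/-! ### Hyperbolic circle patterns -/

/-- A hyperbolic circle pattern on `S` with intersection angle function `D`.

For each edge `e`, with end points `P, Q` and adjacent faces `f, f'`, a hyperbolic quadrilateral
`O_f P O_f' Q` in a copy of the hyperbolic plane belonging to `e`.  If `t` is the flag
`(P, e, f)`, then `O t` is the corner `O_f`, `P t` is the corner `P`, `O (τ₂ t)` is the corner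
`O_f'` and `P (τ₀ t)` is the corner `Q`. -/
structure HypCirclePattern {T : Type*} (S : CellSurface T) (D : S.Edge → ℝ) where
  /-- the radius function -/
  radius : S.Face → ℝ
  radius_pos : ∀ f, 0 < radius f
  /-- the corner of the quadrilateral at the centre of the face -/
  O : T → UpperHalfPlane
  /-- the corner of the quadrilateral at the vertex of the flag -/
  P : T → UpperHalfPlane
  O_τ₀ : ∀ t, O (S.τ₀ t) = O t
  P_τ₂ : ∀ t, P (S.τ₂ t) = P t
  /-- the two ends of an edge are different corners of its quadrilateral -/
  P_ne : ∀ t, P (S.τ₀ t) ≠ P t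
  /-- `|O_f P| = |O_f Q| = r(f)` and `|O_f' P| = |O_f' Q| = r(f')` -/
  dist_eq : ∀ t, dist (O t) (P t) = radius (S.face t)
  /-- `∠ O_f P O_f' = ∠ O_f Q O_f' = π - D(e)` -/
  angle_eq : ∀ t, HypPlane.angle (O t) (P t) (O (S.τ₂ t)) = Real.pi - D (S.edge t)

namespace HypCirclePattern

variable {T : Type*} {S : CellSurface T} {D : S.Edge → ℝ} (C : HypCirclePattern S D)

/-- The angle `φ(f,e)` at `O_f` in the triangle `O_f P O_f'`, for the flag `(P, e, f)`. -/
def phi (t : T) : ℝ := HypPlane.angle (C.P t) (C.O t) (C.O (S.τ₂ t))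

open Classical in
/-- The cone angle at `O_f`, the sum of all angles at `O_f`.  Each side of `f` belongs to two
flags of `f` (one for each end) and so contributes `2 φ(f,e)`. -/
def coneAngle [Fintype T] (f : S.Face) : ℝ :=
  ∑ t ∈ Finset.univ.filter (fun t => S.face t = f), C.phi t

/-- The hyperbolic triangle `O_f P O_f'`, half of the quadrilateral of the edge. -/
def region (t : T) : Set UpperHalfPlane :=
  HypPlane.triangle (C.P t) (C.O t) (C.O (S.τ₂ t))

/-- The disjoint union of the quadrilaterals `O_f P O_f' Q`, over all edges; the quadrilateral is
the union of its triangles `O_f P O_f'` and `O_f Q O_f'`. -/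
def Pieces : Type _ :=
  {p : S.Edge × UpperHalfPlane // ∃ t, S.edge t = p.1 ∧ p.2 ∈ C.region t}

/-- The gluing of the quadrilaterals: if `e, e'` are consecutive sides of `f` at the vertex `P`,
then the side `O_f P` of the quadrilateral of `e` is glued isometrically to the side `O_f P` of
the quadrilateral of `e'`. -/
inductive Glue : C.Pieces → C.Pieces → Prop
  | mk (t : T) (x y : C.Pieces) :
      x.1.1 = S.edge t → x.1.2 ∈ HypPlane.segment (C.O t) (C.P t) →
      y.1.1 = S.edge (S.τ₁ t) → y.1.2 ∈ HypPlane.segment (C.O (S.τ₁ t)) (C.P (S.τ₁ t)) →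
      dist (C.O t) x.1.2 = dist (C.O (S.τ₁ t)) y.1.2 → Glue x y

/-- The surface obtained by gluing together all the quadrilaterals. -/
def Surface : Type _ := Quot C.Glue

/-- The point of the surface given by a point of the triangle of the flag `t`. -/
def pt (t : T) (x : UpperHalfPlane) (hx : x ∈ C.region t) : C.Surface :=
  Quot.mk _ ⟨(S.edge t, x), t, rfl, hx⟩

/-- `IsChain x y L`: the points `x, y` of the surface are joined by a chain of geodesic segments,
each inside one of the hyperbolic triangles, of total length `L`. -/
inductive IsChain : C.Surface → C.Surface → NNReal → Prop
  | nil (x : C.Surface) : IsChain x x 0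
  | snoc (x : C.Surface) (t : T) (y z : UpperHalfPlane) (hy : y ∈ C.region t)
      (hz : z ∈ C.region t) (L : NNReal) :
      IsChain x (C.pt t y hy) L → IsChain x (C.pt t z hz) (L + nndist y z)

/-- The intrinsic distance of the hyperbolic cone metric on the surface (`⊤` between points of
different components). -/
def surfDist (x y : C.Surface) : ENNReal :=
  ⨅ (L : NNReal) (_ : C.IsChain x y L), (L : ENNReal)

/-- The part of the surface covered by the triangle of the flag `t`. -/
def cell (t : T) : Set C.Surface := {p | ∃ x hx, p = C.pt t x hx}

theorem segment_left (a b : UpperHalfPlane) : a ∈ HypPlane.segment a b := by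
  simp [HypPlane.segment]

theorem O_mem (t : T) : C.O t ∈ C.region t :=
  ⟨C.O t, segment_left _ _, by simp [HypPlane.segment]⟩

theorem P_mem (t : T) : C.P t ∈ C.region t :=
  ⟨C.O t, segment_left _ _, segment_left _ _⟩

/-- Two circle patterns on `S` are isometric: there is an isometry between their surfaces which
respects the cell decomposition (each triangle `O_f P O_f'` goes to the corresponding triangle,
vertices to vertices) and takes the circle of each face to the circle of that face, i.e. centre to
centre, with the same radius. -/
def Isometric {D' : S.Edge → ℝ} (C : HypCirclePattern S D) (C' : HypCirclePattern S D') : Prop :=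
  (∀ f, C'.radius f = C.radius f) ∧
  ∃ h : C.Surface ≃ C'.Surface,
    (∀ x y, C'.surfDist (h x) (h y) = C.surfDist x y) ∧
    (∀ t, h '' C.cell t = C'.cell t) ∧
    (∀ t, h (C.pt t (C.O t) (C.O_mem t)) = C'.pt t (C'.O t) (C'.O_mem t)) ∧
    (∀ t, h (C.pt t (C.P t) (C.P_mem t)) = C'.pt t (C'.P t) (C'.P_mem t))

end HypCirclePattern

end

/-! A pattern amounts to its radii: once `r` and `D` are fixed, every triangle `O P O'` has two
sides and the included angle prescribed. Put `x = tanh (r/2)` and `T = tan (D/2)`. The angle at `O`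
is then the closed expression `angleFun T x y`, and the theorem becomes a statement about the system
`totalAngle = Φ` in the cube `(0,1)^F`.

Three facts about `angleFun` carry everything. The two angles of one triangle add up to `2 arctan (T
(1 - xy)/(1 + xy))`, which is below `D` and decreases as both radii grow; the defect from `D` is the
area. An angle strictly decreases in its own radius. It weakly increases in the neighbouring radius.

Necessity: pair the angles triangle by triangle and sum over the faces in `X`; each triangle meeting
`X` contributes less than `D`. Uniqueness: if two solutions differ, compare the angle sums over the
set `X` of faces where one of them is larger. By the three facts this sum is strictly smaller for
the larger radii, although both sums equal that of `Φ`.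

Existence is Perron's method. The radii with cone angles at most `Φ` form a nonempty family closed
under minima; let `x` be its pointwise infimum. If `x` vanished exactly on a nonempty `X`, then in
the limit every triangle meeting `X` would contribute its full `D`, against the assumed strict
inequality. So `x` is positive and belongs to the family, and a face with cone angle below `Φ` could
still be shrunk.

Finally, equal radii make corresponding kites congruent, and these congruences respect the gluing,
hence give an isometry of the surfaces. -/

noncomputable section

namespace HypPlane

open ComplexConjugate

/-! ### Disc coordinates and hyperbolic distance -/

theorem sub_conj_ne_zero (p a : UpperHalfPlane) : (a : ℂ) - conj (p : ℂ) ≠ 0 := by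
  intro h
  have h1 := congrArg Complex.im h
  have h2 := a.im_pos
  have h3 := p.im_pos
  simp at h1
  linarith

theorem one_sub_sq_norm_discCoord (p a : UpperHalfPlane) :
    1 - ‖discCoord p a‖ ^ 2 = 4 * a.im * p.im / ‖(a : ℂ) - conj (p : ℂ)‖ ^ 2 := by
  have h : ‖(a : ℂ) - conj (p : ℂ)‖ ^ 2 ≠ 0 := by
    simpa using sub_conj_ne_zero p a
  rw [discCoord, norm_div, div_pow, one_sub_div h]
  congr 1
  simp only [Complex.sq_norm, Complex.normSq_apply, Complex.sub_re, Complex.sub_im,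
    Complex.conj_re, Complex.conj_im, UpperHalfPlane.coe_re, UpperHalfPlane.coe_im]
  ring

theorem norm_discCoord_lt_one (p a : UpperHalfPlane) : ‖discCoord p a‖ < 1 := by
  have h := one_sub_sq_norm_discCoord p a
  have h1 : 0 < ‖(a : ℂ) - conj (p : ℂ)‖ := norm_pos_iff.2 (sub_conj_ne_zero p a)
  have h2 : 0 < 4 * a.im * p.im / ‖(a : ℂ) - conj (p : ℂ)‖ ^ 2 := by
    have := a.im_pos
    have := p.im_pos
    positivity
  rw [← h] at h2
  nlinarith [norm_nonneg (discCoord p a)]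

@[simp] theorem discCoord_self (p : UpperHalfPlane) : discCoord p p = 0 := by
  simp [discCoord]

/-- The hyperbolic distance in the Poincaré disc centred at `p`. -/
theorem cosh_dist_discCoord (p a b : UpperHalfPlane) :
    Real.cosh (dist a b) = 1 + 2 * ‖discCoord p a - discCoord p b‖ ^ 2 /
      ((1 - ‖discCoord p a‖ ^ 2) * (1 - ‖discCoord p b‖ ^ 2)) := by
  have ha := sub_conj_ne_zero p a
  have hb := sub_conj_ne_zero p b
  have ha' : ‖(a : ℂ) - conj (p : ℂ)‖ ≠ 0 := norm_ne_zero_iff.2 ha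
  have hb' : ‖(b : ℂ) - conj (p : ℂ)‖ ≠ 0 := norm_ne_zero_iff.2 hb
  have h1 := a.im_pos
  have h2 := b.im_pos
  have h3 := p.im_pos
  have key : discCoord p a - discCoord p b = ((a : ℂ) - b) * (p - conj (p : ℂ)) /
      (((a : ℂ) - conj (p : ℂ)) * ((b : ℂ) - conj (p : ℂ))) := by
    rw [discCoord, discCoord, div_sub_div _ _ ha hb]
    congr 1
    ring
  have hp : ‖(p : ℂ) - conj (p : ℂ)‖ ^ 2 = 4 * p.im ^ 2 := by
    simp only [Complex.sq_norm, Complex.normSq_apply, Complex.sub_re, Complex.sub_im,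
      Complex.conj_re, Complex.conj_im, UpperHalfPlane.coe_im]
    ring
  rw [one_sub_sq_norm_discCoord, one_sub_sq_norm_discCoord, key, norm_div, norm_mul, norm_mul,
    div_pow, mul_pow, hp, UpperHalfPlane.cosh_dist, Complex.dist_eq]
  field_simp
  ring

theorem cosh_dist_eq_norm (p a : UpperHalfPlane) :
    Real.cosh (dist p a) = (1 + ‖discCoord p a‖ ^ 2) / (1 - ‖discCoord p a‖ ^ 2) := by
  have h := norm_discCoord_lt_one p a
  have h1 : 1 - ‖discCoord p a‖ ^ 2 ≠ 0 := by nlinarith [norm_nonneg (discCoord p a)]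
  rw [cosh_dist_discCoord p p a]
  simp only [discCoord_self, zero_sub, norm_neg, norm_zero]
  field_simp
  ring

theorem sinh_dist_eq_norm (p a : UpperHalfPlane) :
    Real.sinh (dist p a) = 2 * ‖discCoord p a‖ / (1 - ‖discCoord p a‖ ^ 2) := by
  have h := norm_discCoord_lt_one p a
  have h1 : 0 < 1 - ‖discCoord p a‖ ^ 2 := by nlinarith [norm_nonneg (discCoord p a)]
  have h2 : 0 ≤ Real.sinh (dist p a) := Real.sinh_nonneg_iff.2 dist_nonneg
  have h3 : Real.sinh (dist p a) ^ 2 = (2 * ‖discCoord p a‖ / (1 - ‖discCoord p a‖ ^ 2)) ^ 2 := by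
    rw [Real.sinh_sq, cosh_dist_eq_norm]
    field_simp
    ring
  exact (pow_left_inj₀ h2 (by positivity) two_ne_zero).1 h3

/-- The hyperbolic law of cosines. -/
theorem cosh_dist_law_of_cosines (a p b : UpperHalfPlane) :
    Real.cosh (dist a b) = Real.cosh (dist p a) * Real.cosh (dist p b) -
      Real.sinh (dist p a) * Real.sinh (dist p b) * Real.cos (angle a p b) := by
  have hu := norm_discCoord_lt_one p a
  have hv := norm_discCoord_lt_one p b
  have hu1 : 1 - ‖discCoord p a‖ ^ 2 ≠ 0 := by nlinarith [norm_nonneg (discCoord p a)]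
  have hv1 : 1 - ‖discCoord p b‖ ^ 2 ≠ 0 := by nlinarith [norm_nonneg (discCoord p b)]
  -- The disc is conformal at its centre, so the Euclidean law of cosines for the coordinates turns
  -- into the hyperbolic one.
  have h := InnerProductGeometry.cos_angle_mul_norm_mul_norm (discCoord p a) (discCoord p b)
  rw [cosh_dist_discCoord p a b, cosh_dist_eq_norm, cosh_dist_eq_norm, sinh_dist_eq_norm,
    sinh_dist_eq_norm, norm_sub_sq_real, ← h]
  simp only [angle]
  field_simp
  ring

theorem angle_comm (a p b : UpperHalfPlane) : angle a p b = angle b p a :=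
  InnerProductGeometry.angle_comm _ _

theorem dist_eq_of_cosh_eq {a b : UpperHalfPlane} {r : ℝ} (hr : 0 ≤ r)
    (h : Real.cosh (dist a b) = Real.cosh r) : dist a b = r :=
  Real.cosh_injOn (Set.mem_Ici.2 dist_nonneg) (Set.mem_Ici.2 hr) h

/-- An angle is determined by the law of cosines. -/
theorem angle_eq_of_cosh_eq {a p b : UpperHalfPlane} {θ : ℝ} (hθ : θ ∈ Set.Icc 0 Real.pi)
    (ha : 0 < dist p a) (hb : 0 < dist p b)
    (h : Real.cosh (dist a b) = Real.cosh (dist p a) * Real.cosh (dist p b) -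
      Real.sinh (dist p a) * Real.sinh (dist p b) * Real.cos θ) : angle a p b = θ := by
  have h1 := cosh_dist_law_of_cosines a p b
  have h2 : 0 < Real.sinh (dist p a) * Real.sinh (dist p b) :=
    mul_pos (Real.sinh_pos_iff.2 ha) (Real.sinh_pos_iff.2 hb)
  refine Real.injOn_cos ⟨InnerProductGeometry.angle_nonneg _ _,
    InnerProductGeometry.angle_le_pi _ _⟩ hθ ?_
  refine mul_left_cancel₀ h2.ne' ?_
  change _ * Real.cos (angle a p b) = _
  linarith

/-- The point with given disc coordinate. -/
def ofDiscCoord (p : UpperHalfPlane) (w : ℂ) (hw : ‖w‖ < 1) : UpperHalfPlane :=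
  ⟨((p : ℂ) - conj (p : ℂ) * w) / (1 - w), by
    have h1 : (1 - w) ≠ 0 := by
      intro h
      rw [← sub_eq_zero.1 h] at hw
      simp at hw
    have h2 : 0 < Complex.normSq (1 - w) := Complex.normSq_pos.2 h1
    have h3 : (((p : ℂ) - conj (p : ℂ) * w) / (1 - w)).im =
        p.im * (1 - ‖w‖ ^ 2) / Complex.normSq (1 - w) := by
      rw [Complex.div_im, ← sub_div]
      congr 1
      simp only [Complex.sq_norm, Complex.normSq_apply, Complex.sub_re, Complex.sub_im,
        Complex.mul_re, Complex.mul_im, Complex.conj_re, Complex.conj_im, Complex.one_re,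
        Complex.one_im, UpperHalfPlane.coe_re, UpperHalfPlane.coe_im]
      ring
    rw [h3]
    have := p.im_pos
    have : 0 < 1 - ‖w‖ ^ 2 := by nlinarith [norm_nonneg w]
    positivity⟩

@[simp] theorem discCoord_ofDiscCoord (p : UpperHalfPlane) (w : ℂ) (hw : ‖w‖ < 1) :
    discCoord p (ofDiscCoord p w hw) = w := by
  have h1 : (1 - w) ≠ 0 := by
    intro h
    rw [← sub_eq_zero.1 h] at hw
    simp at hw
  have h2 := sub_conj_ne_zero p p
  simp only [discCoord, ofDiscCoord]
  rw [div_sub' h1, div_sub' h1, div_div_div_cancel_right₀ h1, div_eq_iff]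
  · ring
  · intro h
    apply h2
    rw [← h]
    ring

theorem discCoord_injective (p : UpperHalfPlane) : Function.Injective (discCoord p) := by
  intro a b h
  have h1 := cosh_dist_discCoord p a b
  rw [h, sub_self, norm_zero] at h1
  refine dist_eq_zero.1 (dist_eq_of_cosh_eq le_rfl ?_)
  simpa using h1

/-- The isometry of the hyperbolic plane which is the linear isometry `L` in terms of the disc
coordinates centred at `p` and at `q`. -/
def discIsometry (p q : UpperHalfPlane) (L : ℂ ≃ₗᵢ[ℝ] ℂ) : UpperHalfPlane ≃ᵢ UpperHalfPlane where
  toFun z := ofDiscCoord q (L (discCoord p z))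
    (by rw [L.norm_map]; exact norm_discCoord_lt_one p z)
  invFun z := ofDiscCoord p (L.symm (discCoord q z))
    (by rw [L.symm.norm_map]; exact norm_discCoord_lt_one q z)
  left_inv z := discCoord_injective p (by simp)
  right_inv z := discCoord_injective q (by simp)
  -- The distance formula involves only norms of coordinates and of their difference, all preserved
  -- by `L`.
  isometry_toFun := Isometry.of_dist_eq fun a b => dist_eq_of_cosh_eq dist_nonneg (by
    rw [cosh_dist_discCoord q, cosh_dist_discCoord p a b]
    simp [← map_sub])

theorem discCoord_discIsometry (p q : UpperHalfPlane) (L : ℂ ≃ₗᵢ[ℝ] ℂ) (z : UpperHalfPlane) :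
    discCoord q (discIsometry p q L z) = L (discCoord p z) :=
  discCoord_ofDiscCoord q _ (by rw [L.norm_map]; exact norm_discCoord_lt_one p z)

theorem norm_discCoord_eq {p a q b : UpperHalfPlane} (h : dist p a = dist q b) :
    ‖discCoord p a‖ = ‖discCoord q b‖ := by
  have h1 := cosh_dist_eq_norm p a
  have h2 := cosh_dist_eq_norm q b
  have hu := norm_discCoord_lt_one p a
  have hv := norm_discCoord_lt_one q b
  have hu1 : 1 - ‖discCoord p a‖ ^ 2 ≠ 0 := by nlinarith [norm_nonneg (discCoord p a)]
  have hv1 : 1 - ‖discCoord q b‖ ^ 2 ≠ 0 := by nlinarith [norm_nonneg (discCoord q b)]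
  rw [h, h2, div_eq_div_iff hv1 hu1] at h1
  refine (pow_left_inj₀ (norm_nonneg _) (norm_nonneg _) two_ne_zero).1 ?_
  linarith

/-- Reduces hyperbolic congruence (three sides) to Euclidean congruence of the coordinate triangles
with a vertex at `0`. -/
theorem norm_discCoord_sub_eq {p a b p' a' b' : UpperHalfPlane} (ha : dist p a = dist p' a')
    (hb : dist p b = dist p' b') (hab : dist a b = dist a' b') :
    ‖discCoord p a - discCoord p b‖ = ‖discCoord p' a' - discCoord p' b'‖ := by
  have h1 := cosh_dist_discCoord p a b
  have h2 := cosh_dist_discCoord p' a' b'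
  rw [norm_discCoord_eq ha, norm_discCoord_eq hb, hab, h2] at h1
  have hu := norm_discCoord_lt_one p' a'
  have hv := norm_discCoord_lt_one p' b'
  have hu1 : 1 - ‖discCoord p' a'‖ ^ 2 ≠ 0 := by nlinarith [norm_nonneg (discCoord p' a')]
  have hv1 : 1 - ‖discCoord p' b'‖ ^ 2 ≠ 0 := by nlinarith [norm_nonneg (discCoord p' b')]
  refine (pow_left_inj₀ (norm_nonneg _) (norm_nonneg _) two_ne_zero).1 ?_
  rw [add_right_inj, div_left_inj' (mul_ne_zero hu1 hv1)] at h1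
  linarith

/-! ### Plane Euclidean congruence -/

/-- Circles centred at `0` and `1` meet in a pair of points symmetric in the real axis. -/
theorem eq_or_eq_conj_of_norm_eq {v w : ℂ} (h1 : ‖v‖ = ‖w‖) (h2 : ‖1 - v‖ = ‖1 - w‖) :
    w = v ∨ w = conj v := by
  have e1 : ‖v‖ ^ 2 = ‖w‖ ^ 2 := by rw [h1]
  have e2 : ‖1 - v‖ ^ 2 = ‖1 - w‖ ^ 2 := by rw [h2]
  simp only [Complex.sq_norm, Complex.normSq_apply, Complex.sub_re, Complex.sub_im,
    Complex.one_re, Complex.one_im] at e1 e2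
  have e3 : w.re = v.re := by linarith
  rw [e3] at e1
  have e4 : w.im ^ 2 = v.im ^ 2 := by linarith
  rcases sq_eq_sq_iff_eq_or_eq_neg.1 e4 with h | h
  · exact Or.inl (Complex.ext e3 h)
  · exact Or.inr (Complex.ext (by simpa using e3) (by simpa using h))

/-- A triangle with a vertex at `0` is determined by its sides up to a linear isometry. -/
theorem exists_linearIsometry {u v u' v' : ℂ} (hu : u ≠ 0) (h1 : ‖u‖ = ‖u'‖) (h2 : ‖v‖ = ‖v'‖)
    (h3 : ‖u - v‖ = ‖u' - v'‖) : ∃ L : ℂ ≃ₗᵢ[ℝ] ℂ, L u = u' ∧ L v = v' := by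
  have hn : ‖u‖ ≠ 0 := norm_ne_zero_iff.2 hu
  have hu' : u' ≠ 0 := norm_ne_zero_iff.1 (h1 ▸ hn)
  have hdiv : ∀ a b : ℂ, b ≠ 0 → 1 - a / b = (b - a) / b := fun a b hb => by
    field_simp
  -- Division by `u` and `u'` moves the second vertex to `1`; the two alternatives give a rotation
  -- or a reflection.
  have hcase : v' / u' = v / u ∨ v' / u' = conj (v / u) := by
    refine eq_or_eq_conj_of_norm_eq ?_ ?_
    · rw [norm_div, norm_div, h1, h2]
    · rw [hdiv _ _ hu, hdiv _ _ hu', norm_div, norm_div, h1, h3]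
  have hrot : ∀ z : ℂ, ‖z‖ = ‖u'‖ → ∃ c : Circle, (c : ℂ) = u' / z := by
    intro z hz
    exact ⟨⟨u' / z, by simp [Submonoid.unitSphere, hz, hu']⟩, rfl⟩
  rcases hcase with h | h
  · obtain ⟨c, hc⟩ := hrot u h1
    refine ⟨rotation c, ?_, ?_⟩
    · rw [rotation_apply, hc, div_mul_cancel₀ _ hu]
    · rw [rotation_apply, hc]
      rw [div_eq_div_iff hu' hu] at h
      field_simp
      linear_combination -h
  · have hu0 : conj u ≠ 0 := (map_ne_zero _).2 hu
    obtain ⟨c, hc⟩ := hrot (conj u) (by simpa using h1)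
    refine ⟨Complex.conjLIE.trans (rotation c), ?_, ?_⟩
    · rw [LinearIsometryEquiv.trans_apply, rotation_apply, Complex.conjLIE_apply, hc,
        div_mul_cancel₀ _ hu0]
    · rw [LinearIsometryEquiv.trans_apply, rotation_apply, Complex.conjLIE_apply, hc]
      rw [map_div₀, div_eq_div_iff hu' hu0] at h
      field_simp
      linear_combination -h

/-- The circles about `0` and `u` through `v` share at most one further point. This fixes the corner
`Q` of a kite once `P` is placed. -/
theorem eq_of_norm_eq_of_ne {u v w w' : ℂ} (hu : u ≠ 0) (h1 : ‖w‖ = ‖v‖) (h2 : ‖w'‖ = ‖v‖)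
    (h3 : ‖u - w‖ = ‖u - v‖) (h4 : ‖u - w'‖ = ‖u - v‖) (hw : w ≠ v) (hw' : w' ≠ v) : w = w' := by
  have hdiv : ∀ a b : ℂ, b ≠ 0 → 1 - a / b = (b - a) / b := fun a b hb => by
    field_simp
  have key : ∀ z : ℂ, ‖z‖ = ‖v‖ → ‖u - z‖ = ‖u - v‖ → z ≠ v → z / u = conj (v / u) := by
    intro z hz1 hz2 hz3
    refine (eq_or_eq_conj_of_norm_eq (v := v / u) (w := z / u) ?_ ?_).resolve_left ?_
    · rw [norm_div, norm_div, hz1]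
    · rw [hdiv _ _ hu, hdiv _ _ hu, norm_div, norm_div, hz2]
    · exact fun h => hz3 ((div_left_inj' hu).1 h)
  exact (div_left_inj' hu).1 ((key w h1 h3 hw).trans (key w' h2 h4 hw').symm)

/-- Two congruent kites `O P O' Q` are related by an isometry of the hyperbolic plane. -/
theorem exists_isometry_of_kite {o a p q o₁ a₁ p₁ q₁ : UpperHalfPlane} (hoa : o ≠ a)
    (h1 : dist o a = dist o₁ a₁) (h2 : dist o p = dist o₁ p₁) (h3 : dist a p = dist a₁ p₁)
    (h4 : dist o q = dist o p) (h5 : dist a q = dist a p) (h6 : dist o₁ q₁ = dist o₁ p₁)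
    (h7 : dist a₁ q₁ = dist a₁ p₁) (hq : q ≠ p) (hq₁ : q₁ ≠ p₁) :
    ∃ g : UpperHalfPlane ≃ᵢ UpperHalfPlane, g o = o₁ ∧ g a = a₁ ∧ g p = p₁ ∧ g q = q₁ := by
  have hu : discCoord o a ≠ 0 := fun h =>
    hoa (discCoord_injective o (h.trans (discCoord_self o).symm)).symm
  obtain ⟨L, hL1, hL2⟩ := exists_linearIsometry hu (norm_discCoord_eq h1) (norm_discCoord_eq h2)
    (norm_discCoord_sub_eq h1 h2 h3)
  refine ⟨discIsometry o o₁ L, discCoord_injective o₁ ?_, discCoord_injective o₁ ?_,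
    discCoord_injective o₁ ?_, discCoord_injective o₁ ?_⟩
  · rw [discCoord_discIsometry, discCoord_self, discCoord_self, map_zero]
  · rw [discCoord_discIsometry, hL1]
  · rw [discCoord_discIsometry, hL2]
  · rw [discCoord_discIsometry]
    refine eq_of_norm_eq_of_ne (u := discCoord o₁ a₁) (v := discCoord o₁ p₁) ?_ ?_ ?_ ?_ ?_ ?_ ?_
    · rw [← hL1]
      exact (map_ne_zero_iff L L.injective).2 hu
    · rw [L.norm_map, ← hL2, L.norm_map]
      exact norm_discCoord_eq h4
    · exact norm_discCoord_eq h6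
    · rw [← hL1, ← hL2, ← map_sub, ← map_sub, L.norm_map, L.norm_map]
      exact norm_discCoord_sub_eq rfl h4 h5
    · exact norm_discCoord_sub_eq rfl h6 h7
    · rw [← hL2]
      exact fun h => hq (discCoord_injective o (L.injective h))
    · exact fun h => hq₁ (discCoord_injective o₁ h)

end HypPlane


namespace HypPlane

/-! ### The angle at the centre as a function of the radii -/

/-- The angle at `O` in the hyperbolic triangle `O P O'` with `x = tanh (|OP| / 2)`,
`y = tanh (|O'P| / 2)` and exterior angle `2 arctan T` at `P`. -/
def angleFun (T x y : ℝ) : ℝ :=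
  Real.arctan (T * (1 - x * y) / (1 + x * y)) + Real.arctan (T * (y - x) / (x + y))

/-- The second arctangent is odd under exchanging `x` and `y`, the first is symmetric. -/
theorem angleFun_add_swap (T x y : ℝ) :
    angleFun T x y + angleFun T y x = 2 * Real.arctan (T * (1 - x * y) / (1 + x * y)) := by
  have h : T * (x - y) / (y + x) = -(T * (y - x) / (x + y)) := by
    rw [add_comm y x, ← neg_div, ← mul_neg, neg_sub]
  rw [angleFun, angleFun, h, Real.arctan_neg, mul_comm y x]
  ring

theorem one_sub_div_one_add_strictAnti {T a b : ℝ} (hT : 0 < T) (ha : 0 ≤ a) (hab : a < b) :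
    T * (1 - b) / (1 + b) < T * (1 - a) / (1 + a) := by
  rw [div_lt_div_iff₀ (by linarith) (by linarith)]
  nlinarith [mul_pos hT (sub_pos.2 hab)]

theorem angleFun_add_swap_lt {T x y : ℝ} (hT : 0 < T) (hx : 0 < x) (hy : 0 < y) :
    angleFun T x y + angleFun T y x < 2 * Real.arctan T := by
  rw [angleFun_add_swap]
  have h := one_sub_div_one_add_strictAnti hT le_rfl (mul_pos hx hy)
  simp only [sub_zero, mul_one, add_zero, div_one] at h
  linarith [Real.arctan_strictMono h]

theorem angleFun_add_swap_strictAnti {T x y x' y' : ℝ} (hT : 0 < T) (hx : 0 < x) (hy : 0 < y)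
    (hxx : x < x') (hyy : y < y') :
    angleFun T x' y' + angleFun T y' x' < angleFun T x y + angleFun T y x := by
  rw [angleFun_add_swap, angleFun_add_swap]
  have h : x * y < x' * y' := mul_lt_mul'' hxx hyy hx.le hy.le
  linarith [Real.arctan_strictMono
    (one_sub_div_one_add_strictAnti hT (mul_pos hx hy).le h)]

theorem angleFun_pos {T x y : ℝ} (hT : 0 < T) (hx : x ∈ Set.Ioo (0 : ℝ) 1) (hy : 0 < y) :
    0 < angleFun T x y := by
  obtain ⟨hx0, hx1⟩ := hx
  have h : -(T * (y - x) / (x + y)) < T * (1 - x * y) / (1 + x * y) := by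
    rw [← neg_div, div_lt_div_iff₀ (by positivity) (by positivity)]
    have : 0 < T * y * (1 - x ^ 2) := by
      have : 0 < 1 - x ^ 2 := by nlinarith
      positivity
    nlinarith
  have h' := Real.arctan_strictMono h
  rw [Real.arctan_neg] at h'
  rw [angleFun]
  linarith

theorem angleFun_lt {T x y : ℝ} (hT : 0 < T) (hx : 0 < x) (hy : y ∈ Set.Ioo (0 : ℝ) 1) :
    angleFun T x y < 2 * Real.arctan T := by
  linarith [angleFun_pos hT hy hx, angleFun_add_swap_lt hT hx hy.1]

theorem angleFun_strictAnti_left {T x x' y : ℝ} (hT : 0 < T) (hx : 0 < x) (hxx : x < x')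
    (hy : 0 < y) : angleFun T x' y < angleFun T x y := by
  have h1 := one_sub_div_one_add_strictAnti hT (mul_pos hx hy).le (mul_lt_mul_of_pos_right hxx hy)
  have h2 : T * (y - x') / (x' + y) < T * (y - x) / (x + y) := by
    rw [div_lt_div_iff₀ (by linarith) (by linarith)]
    nlinarith [mul_pos (mul_pos hT hy) (sub_pos.2 hxx)]
  rw [angleFun, angleFun]
  linarith [Real.arctan_strictMono h1, Real.arctan_strictMono h2]

theorem hasDerivAt_angleFun {T x y : ℝ} (hx : 0 < x) (hy : 0 < y) :
    HasDerivAt (fun y => angleFun T x y)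
      (1 / (1 + (T * (1 - x * y) / (1 + x * y)) ^ 2) *
        ((T * -x * (1 + x * y) - T * (1 - x * y) * x) / (1 + x * y) ^ 2) +
      1 / (1 + (T * (y - x) / (x + y)) ^ 2) *
        ((T * 1 * (x + y) - T * (y - x) * 1) / (x + y) ^ 2)) y := by
  have hm : HasDerivAt (fun y => x * y) x y := by simpa using (hasDerivAt_id y).const_mul x
  refine HasDerivAt.add (HasDerivAt.arctan (HasDerivAt.div ?_ ?_ ?_))
    (HasDerivAt.arctan (HasDerivAt.div ?_ ?_ ?_))
  · exact (hm.const_sub 1).const_mul T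
  · exact hm.const_add 1
  · positivity
  · exact ((hasDerivAt_id y).sub_const x).const_mul T
  · exact (hasDerivAt_id y).const_add x
  · positivity

/-- The two arctangents vary in opposite directions with `y`, so the derivative is needed. Its sign
comes from `(1 + xz)² + T²(1 - xz)² - (x + z)² - T²(z - x)² = (1 + T²)(1 - x²)(1 - z²)`. -/
theorem angleFun_monotone_right {T x y y' : ℝ} (hT : 0 < T) (hx : x ∈ Set.Ioo (0 : ℝ) 1)
    (hy : 0 < y) (hyy : y ≤ y') (hy' : y' < 1) : angleFun T x y ≤ angleFun T x y' := by
  obtain ⟨hx0, hx1⟩ := hx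
  have hmono : MonotoneOn (fun y => angleFun T x y) (Set.Ioo 0 1) := by
    refine monotoneOn_of_deriv_nonneg (convex_Ioo 0 1) ?_ ?_ ?_
    · exact fun z hz => (hasDerivAt_angleFun hx0 hz.1).continuousAt.continuousWithinAt
    · rw [interior_Ioo]
      exact fun z hz => (hasDerivAt_angleFun hx0 hz.1).differentiableAt.differentiableWithinAt
    · rw [interior_Ioo]
      intro z hz
      rw [(hasDerivAt_angleFun hx0 hz.1).deriv]
      obtain ⟨hz0, hz1⟩ := hz
      have hM : 0 < (1 + x * z) ^ 2 + (T * (1 - x * z)) ^ 2 := by positivity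
      have hN : 0 < (x + z) ^ 2 + (T * (z - x)) ^ 2 := by positivity
      have hp : 0 < 1 + x * z := by positivity
      have hs : 0 < x + z := by positivity
      have e : (1 / (1 + (T * (1 - x * z) / (1 + x * z)) ^ 2) *
          ((T * -x * (1 + x * z) - T * (1 - x * z) * x) / (1 + x * z) ^ 2) +
          1 / (1 + (T * (z - x) / (x + z)) ^ 2) *
          ((T * 1 * (x + z) - T * (z - x) * 1) / (x + z) ^ 2)) =
          2 * x * T * (1 / ((x + z) ^ 2 + (T * (z - x)) ^ 2) -
            1 / ((1 + x * z) ^ 2 + (T * (1 - x * z)) ^ 2)) := by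
        rw [div_pow, div_pow, one_add_div (by positivity), one_add_div (by positivity)]
        field_simp
        ring
      rw [e]
      refine mul_nonneg (by positivity) (sub_nonneg.2 (one_div_le_one_div_of_le hN ?_))
      have h1 : 0 < (1 - x ^ 2) * (1 - z ^ 2) := mul_pos (by nlinarith) (by nlinarith)
      nlinarith [mul_pos (mul_pos hT hT) h1]
  exact hmono ⟨hy, hyy.trans_lt hy'⟩ ⟨hy.trans_le hyy, hy'⟩ hyy

/-- One radius may be zero, but not both: the second arctangent has no limit at `(0, 0)`. -/
theorem continuousAt_angleFun {T x y : ℝ} (hx : 0 ≤ x) (hy : 0 ≤ y) (hxy : 0 < x + y) :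
    ContinuousAt (fun p : ℝ × ℝ => angleFun T p.1 p.2) (x, y) := by
  have h1 : 1 + x * y ≠ 0 := by positivity
  unfold angleFun
  refine ContinuousAt.add
    (Real.continuous_arctan.continuousAt.comp (ContinuousAt.div (by fun_prop) (by fun_prop) h1))
    (Real.continuous_arctan.continuousAt.comp
      (ContinuousAt.div (by fun_prop) (by fun_prop) hxy.ne'))

/-! ### Trigonometry of the triangle with given radii -/

theorem cosh_eq_tanh_half (r : ℝ) :
    Real.cosh r = (1 + Real.tanh (r / 2) ^ 2) / (1 - Real.tanh (r / 2) ^ 2) := by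
  have hc := Real.cosh_pos (r / 2)
  have h := Real.cosh_sq_sub_sinh_sq (r / 2)
  have h2 := Real.cosh_two_mul (r / 2)
  rw [mul_div_cancel₀ r two_ne_zero] at h2
  rw [Real.tanh_eq_sinh_div_cosh, div_pow, one_add_div (by positivity),
    one_sub_div (by positivity), div_div_div_cancel_right₀ (by positivity), h, h2, div_one]

theorem sinh_eq_tanh_half (r : ℝ) :
    Real.sinh r = 2 * Real.tanh (r / 2) / (1 - Real.tanh (r / 2) ^ 2) := by
  have hc := Real.cosh_pos (r / 2)
  have h := Real.cosh_sq_sub_sinh_sq (r / 2)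
  have h2 := Real.sinh_two_mul (r / 2)
  rw [mul_div_cancel₀ r two_ne_zero] at h2
  rw [Real.tanh_eq_sinh_div_cosh, div_pow, one_sub_div (by positivity), h, h2]
  field_simp

theorem tanh_half_mem {r : ℝ} (hr : 0 < r) : Real.tanh (r / 2) ∈ Set.Ioo (0 : ℝ) 1 := by
  rw [Real.tanh_eq_sinh_div_cosh]
  refine ⟨div_pos (Real.sinh_pos_iff.2 (by linarith)) (Real.cosh_pos _), ?_⟩
  rw [div_lt_one (Real.cosh_pos _)]
  exact Real.sinh_lt_cosh _

theorem cos_eq_tan_half {δ : ℝ} (hδ : δ ∈ Set.Ioo 0 Real.pi) :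
    Real.cos δ = (1 - Real.tan (δ / 2) ^ 2) / (1 + Real.tan (δ / 2) ^ 2) := by
  have hc : 0 < Real.cos (δ / 2) :=
    Real.cos_pos_of_mem_Ioo ⟨by linarith [hδ.1, Real.pi_pos], by linarith [hδ.2]⟩
  have h := Real.sin_sq_add_cos_sq (δ / 2)
  have h2 := Real.cos_two_mul' (δ / 2)
  rw [mul_div_cancel₀ δ two_ne_zero] at h2
  rw [Real.tan_eq_sin_div_cos, div_pow, one_sub_div (by positivity), one_add_div (by positivity),
    div_div_div_cancel_right₀ (by positivity), h2, add_comm (Real.cos (δ / 2) ^ 2), h, div_one]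

theorem tan_half_pos {δ : ℝ} (hδ : δ ∈ Set.Ioo 0 Real.pi) : 0 < Real.tan (δ / 2) :=
  Real.tan_pos_of_pos_of_lt_pi_div_two (by linarith [hδ.1]) (by linarith [hδ.2])

theorem two_arctan_tan_half {δ : ℝ} (hδ : δ ∈ Set.Ioo 0 Real.pi) :
    2 * Real.arctan (Real.tan (δ / 2)) = δ := by
  rw [Real.arctan_tan (by linarith [hδ.1, Real.pi_pos]) (by linarith [hδ.2])]
  ring

/-- Since `cos δ > -1`, the expression exceeds `cosh (r - r') ≥ 1`. Hence the two centres of a kite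
are distinct. -/
theorem one_lt_cosh_law {r r' δ : ℝ} (hr : 0 < r) (hr' : 0 < r') (hδ : δ ∈ Set.Ioo 0 Real.pi) :
    1 < Real.cosh r * Real.cosh r' + Real.sinh r * Real.sinh r' * Real.cos δ := by
  have h1 : -1 < Real.cos δ := by
    rw [← Real.cos_pi]
    exact Real.cos_lt_cos_of_nonneg_of_le_pi hδ.1.le le_rfl hδ.2
  have h2 : 0 < Real.sinh r * Real.sinh r' :=
    mul_pos (Real.sinh_pos_iff.2 hr) (Real.sinh_pos_iff.2 hr')
  have h3 := Real.one_le_cosh (r - r')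
  rw [Real.cosh_sub] at h3
  nlinarith

/-- The law of cosines with the angle `angleFun`. -/
theorem cosh_eq_angleFun {r r' d δ : ℝ} (hr : 0 < r) (hr' : 0 < r') (hd : 0 ≤ d)
    (hδ : δ ∈ Set.Ioo 0 Real.pi)
    (h : Real.cosh d = Real.cosh r * Real.cosh r' + Real.sinh r * Real.sinh r' * Real.cos δ) :
    Real.cosh r' = Real.cosh r * Real.cosh d - Real.sinh r * Real.sinh d *
      Real.cos (angleFun (Real.tan (δ / 2)) (Real.tanh (r / 2)) (Real.tanh (r' / 2))) := by
  obtain ⟨hx0, hx1⟩ := tanh_half_mem hr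
  obtain ⟨hy0, hy1⟩ := tanh_half_mem hr'
  have hT := tan_half_pos hδ
  rw [cosh_eq_tanh_half r, cosh_eq_tanh_half r', sinh_eq_tanh_half r, sinh_eq_tanh_half r',
    cos_eq_tan_half hδ] at h
  rw [cosh_eq_tanh_half r, cosh_eq_tanh_half r', sinh_eq_tanh_half r]
  generalize Real.tanh (r / 2) = x at *
  generalize Real.tanh (r' / 2) = y at *
  generalize Real.tan (δ / 2) = T at *
  have hX : 0 < 1 - x ^ 2 := by nlinarith
  have hY : 0 < 1 - y ^ 2 := by nlinarith
  -- Up to a common factor `M` and `N` are `cosh d + 1` and `cosh d - 1`, so `sinh d` is a multiple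
  -- of `√M √N`. The same roots occur in the cosines and sines of the two arctangents and cancel in
  -- `sinh d * cos`.
  set M := (1 + x * y) ^ 2 + (T * (1 - x * y)) ^ 2 with hM
  set N := (x + y) ^ 2 + (T * (y - x)) ^ 2 with hN
  have hM0 : 0 < M := by positivity
  have hN0 : 0 < N := by positivity
  have hp : 0 < 1 + x * y := by positivity
  have hs : 0 < x + y := by positivity
  have hsinh : Real.sinh d = 2 * (√M * √N) / ((1 + T ^ 2) * (1 - x ^ 2) * (1 - y ^ 2)) := by
    refine (pow_left_inj₀ (Real.sinh_nonneg_iff.2 hd) (by positivity) two_ne_zero).1 ?_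
    rw [Real.sinh_sq, h, div_pow, mul_pow 2, mul_pow (√M), Real.sq_sqrt hM0.le, Real.sq_sqrt hN0.le,
      hM, hN]
    field_simp
    ring
  have hA : √(1 + (T * (1 - x * y) / (1 + x * y)) ^ 2) = √M / (1 + x * y) := by
    rw [div_pow, one_add_div (by positivity), Real.sqrt_div hM0.le, Real.sqrt_sq hp.le]
  have hB : √(1 + (T * (y - x) / (x + y)) ^ 2) = √N / (x + y) := by
    rw [div_pow, one_add_div (by positivity), Real.sqrt_div hN0.le, Real.sqrt_sq hs.le]
  have hcos : Real.cos (angleFun T x y) =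
      ((1 + x * y) * (x + y) - T ^ 2 * (1 - x * y) * (y - x)) / (√M * √N) := by
    rw [angleFun, Real.cos_add, Real.cos_arctan, Real.cos_arctan, Real.sin_arctan,
      Real.sin_arctan, hA, hB]
    have := Real.sqrt_pos.2 hM0
    have := Real.sqrt_pos.2 hN0
    field_simp
  have hprod : Real.sinh d * Real.cos (angleFun T x y) =
      2 * ((1 + x * y) * (x + y) - T ^ 2 * (1 - x * y) * (y - x)) /
        ((1 + T ^ 2) * (1 - x ^ 2) * (1 - y ^ 2)) := by
    rw [hsinh, hcos]
    have := Real.sqrt_pos.2 hM0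
    have := Real.sqrt_pos.2 hN0
    field_simp
  rw [mul_assoc, hprod, h]
  field_simp
  ring

theorem angleFun_mem {r r' δ : ℝ} (hr : 0 < r) (hr' : 0 < r') (hδ : δ ∈ Set.Ioo 0 Real.pi) :
    angleFun (Real.tan (δ / 2)) (Real.tanh (r / 2)) (Real.tanh (r' / 2)) ∈
      Set.Ioo 0 Real.pi := by
  have hT := tan_half_pos hδ
  refine ⟨angleFun_pos hT (tanh_half_mem hr) (tanh_half_mem hr').1, ?_⟩
  have := angleFun_lt hT (tanh_half_mem hr).1 (tanh_half_mem hr')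
  rw [two_arctan_tan_half hδ] at this
  exact this.trans hδ.2

/-- The length of `O O'` in a triangle `O P O'` with angle `π - δ` at `P`. -/
theorem cosh_dist_of_angle {o p a : UpperHalfPlane} {δ : ℝ} (h : angle o p a = Real.pi - δ) :
    Real.cosh (dist o a) = Real.cosh (dist o p) * Real.cosh (dist a p) +
      Real.sinh (dist o p) * Real.sinh (dist a p) * Real.cos δ := by
  rw [cosh_dist_law_of_cosines o p a, h, Real.cos_pi_sub, dist_comm p o, dist_comm p a]
  ring

theorem ne_of_angle {o p a : UpperHalfPlane} {δ : ℝ} (hδ : δ ∈ Set.Ioo 0 Real.pi)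
    (h : angle o p a = Real.pi - δ) (hp : 0 < dist o p) (ha : 0 < dist a p) : o ≠ a := by
  rintro rfl
  have h1 := cosh_dist_of_angle h
  have h2 := one_lt_cosh_law hp ha hδ
  rw [← h1, dist_self, Real.cosh_zero] at h2
  exact lt_irrefl _ h2

/-- The angle at `O` in a triangle `O P O'` with angle `π - δ` at `P`. -/
theorem angle_eq_angleFun {o p a : UpperHalfPlane} {δ : ℝ} (hδ : δ ∈ Set.Ioo 0 Real.pi)
    (h : angle o p a = Real.pi - δ) (hp : 0 < dist o p) (ha : 0 < dist a p) :
    angle p o a = angleFun (Real.tan (δ / 2)) (Real.tanh (dist o p / 2))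
      (Real.tanh (dist a p / 2)) := by
  have h1 := cosh_dist_of_angle h
  have h2 := cosh_eq_angleFun hp ha dist_nonneg hδ h1
  refine angle_eq_of_cosh_eq (Set.Ioo_subset_Icc_self (angleFun_mem hp ha hδ)) hp
    (dist_pos.2 (ne_of_angle hδ h hp ha)) ?_
  rw [dist_comm p a, h2]

/-- There are hyperbolic kites with given radii and intersection angle. -/
theorem exists_kite {r r' δ : ℝ} (hr : 0 < r) (hr' : 0 < r') (hδ : δ ∈ Set.Ioo 0 Real.pi) :
    ∃ o a p q : UpperHalfPlane, dist o p = r ∧ dist o q = r ∧ dist a p = r' ∧ dist a q = r' ∧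
      angle o p a = Real.pi - δ ∧ angle o q a = Real.pi - δ ∧ q ≠ p := by
  obtain ⟨d, hd0, hd⟩ := Real.cosh_surjOn
    (show Real.cosh r * Real.cosh r' + Real.sinh r * Real.sinh r' * Real.cos δ ∈ Set.Ici 1 from
      (one_lt_cosh_law hr hr' hδ).le)
  have hd1 : 0 < d := by
    refine lt_of_le_of_ne hd0 fun h => ?_
    have := one_lt_cosh_law hr hr' hδ
    rw [← hd, ← h, Real.cosh_zero] at this
    exact lt_irrefl _ this
  set φ := angleFun (Real.tan (δ / 2)) (Real.tanh (r / 2)) (Real.tanh (r' / 2)) with hφ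
  have hφm : φ ∈ Set.Ioo 0 Real.pi := angleFun_mem hr hr' hδ
  have hlaw : Real.cosh r' = Real.cosh r * Real.cosh d - Real.sinh r * Real.sinh d * Real.cos φ :=
    cosh_eq_angleFun hr hr' hd1.le hδ hd
  obtain ⟨hx0, hx1⟩ := tanh_half_mem hr
  obtain ⟨hk0, hk1⟩ := tanh_half_mem hd1
  set x := Real.tanh (r / 2) with hx
  set k := Real.tanh (d / 2) with hk
  have hX : 0 < 1 - x ^ 2 := by nlinarith
  have hK : 0 < 1 - k ^ 2 := by nlinarith
  have hpt : ∀ s : ℝ, s ^ 2 = Real.sin φ ^ 2 →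
      ‖(⟨x * Real.cos φ, x * s⟩ : ℂ)‖ = x := by
    intro s hs
    refine (pow_left_inj₀ (norm_nonneg _) hx0.le two_ne_zero).1 ?_
    rw [Complex.sq_norm, Complex.normSq_apply]
    linear_combination x ^ 2 * hs + x ^ 2 * Real.sin_sq_add_cos_sq φ
  have hkn : ‖(k : ℂ)‖ = k := by rw [Complex.norm_real, Real.norm_of_nonneg hk0.le]
  let o : UpperHalfPlane := UpperHalfPlane.I
  let a : UpperHalfPlane := ofDiscCoord o k (hkn.trans_lt hk1)
  -- With `o` at the disc centre and `a` on the real axis, `p` and `q` are mirror images. Only the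
  -- square of the imaginary part enters, so both are handled together with `s = ± sin φ`.
  have key : ∀ (s : ℝ) (hs : s ^ 2 = Real.sin φ ^ 2) (p : UpperHalfPlane),
      discCoord o p = ⟨x * Real.cos φ, x * s⟩ →
      dist o p = r ∧ dist a p = r' ∧ angle o p a = Real.pi - δ := by
    intro s hs p hp
    have h1 : dist o p = r := by
      refine dist_eq_of_cosh_eq hr.le ?_
      rw [cosh_dist_eq_norm, hp, hpt s hs, cosh_eq_tanh_half r]
    have h2 : dist o a = d := by
      refine dist_eq_of_cosh_eq hd1.le ?_
      rw [cosh_dist_eq_norm, discCoord_ofDiscCoord, hkn, cosh_eq_tanh_half d]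
    have h3 : dist a p = r' := by
      refine dist_eq_of_cosh_eq hr'.le ?_
      have h4 : ‖(k : ℂ) - ⟨x * Real.cos φ, x * s⟩‖ ^ 2 =
          k ^ 2 + x ^ 2 - 2 * k * x * Real.cos φ := by
        rw [Complex.sq_norm, Complex.normSq_apply]
        simp only [Complex.sub_re, Complex.sub_im, Complex.ofReal_re, Complex.ofReal_im]
        linear_combination x ^ 2 * hs + x ^ 2 * Real.sin_sq_add_cos_sq φ
      rw [cosh_dist_discCoord o, discCoord_ofDiscCoord, hp, h4, hpt s hs, hkn, hlaw,
        cosh_eq_tanh_half r, cosh_eq_tanh_half d, sinh_eq_tanh_half r, sinh_eq_tanh_half d,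
        ← hx, ← hk]
      field_simp
      ring
    refine ⟨h1, h3, angle_eq_of_cosh_eq ⟨by linarith [hδ.2], by linarith [hδ.1]⟩ ?_ ?_ ?_⟩
    · rwa [dist_comm, h1]
    · rwa [dist_comm, h3]
    · rw [dist_comm p o, dist_comm p a, h1, h2, h3, hd, Real.cos_pi_sub]
      ring
  let p := ofDiscCoord o ⟨x * Real.cos φ, x * Real.sin φ⟩ ((hpt _ rfl).trans_lt hx1)
  let q := ofDiscCoord o ⟨x * Real.cos φ, x * -Real.sin φ⟩ ((hpt _ (neg_sq _)).trans_lt hx1)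
  obtain ⟨p1, p2, p3⟩ := key _ rfl p (discCoord_ofDiscCoord _ _ _)
  obtain ⟨q1, q2, q3⟩ := key _ (neg_sq _) q (discCoord_ofDiscCoord _ _ _)
  refine ⟨o, a, p, q, p1, q1, p2, q2, p3, q3, fun h => ?_⟩
  have h1 := congrArg (fun z => (discCoord o z).im) h
  simp only [p, q, discCoord_ofDiscCoord] at h1
  have h2 := mul_pos hx0 (Real.sin_pos_of_mem_Ioo hφm)
  linarith

end HypPlane


namespace CellSurface

variable {T : Type*} (S : CellSurface T)

/-! ### Flags of an edge and double counting -/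

@[simp] theorem face_τ₀ (t : T) : S.face (S.τ₀ t) = S.face t :=
  (Quot.sound (r := fun s t : T => t = S.τ₀ s ∨ t = S.τ₁ s) (Or.inl rfl)).symm

@[simp] theorem edge_τ₀ (t : T) : S.edge (S.τ₀ t) = S.edge t :=
  (Quot.sound (r := fun s t : T => t = S.τ₀ s ∨ t = S.τ₂ s) (Or.inl rfl)).symm

@[simp] theorem edge_τ₂ (t : T) : S.edge (S.τ₂ t) = S.edge t :=
  (Quot.sound (r := fun s t : T => t = S.τ₀ s ∨ t = S.τ₂ s) (Or.inr rfl)).symm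

/-- Because `τ₀` and `τ₂` are commuting involutions, the four listed flags form a set that is
constant on the generating relation and descends to the quotient. -/
theorem edge_eq_iff {s t : T} : S.edge s = S.edge t ↔
    s = t ∨ s = S.τ₀ t ∨ s = S.τ₂ t ∨ s = S.τ₀ (S.τ₂ t) := by
  constructor
  · intro h
    let orb : T → Set T := fun t => {t, S.τ₀ t, S.τ₂ t, S.τ₀ (S.τ₂ t)}
    have horb : ∀ a b : T, (b = S.τ₀ a ∨ b = S.τ₂ a) → orb a = orb b := by
      rintro a b (rfl | rfl) <;> ext z <;>
        simp only [orb, Set.mem_insert_iff, Set.mem_singleton_iff, S.τ₀_invol, S.τ₂_invol,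
          ← S.τ₀_τ₂_comm] <;> tauto
    have h2 : orb s = orb t := congrArg (Quot.lift orb horb) h
    have h3 : s ∈ orb s := Or.inl rfl
    rw [h2] at h3
    exact h3
  · rintro (rfl | rfl | rfl | rfl) <;> simp

open Classical in
theorem card_edge_fiber [Fintype T] (e : S.Edge) :
    (Finset.univ.filter (fun t => S.edge t = e)).card = 4 := by
  obtain ⟨t, rfl⟩ : ∃ t, S.edge t = e := Quot.exists_rep e
  have h : Finset.univ.filter (fun s => S.edge s = S.edge t) =
      {t, S.τ₀ t, S.τ₂ t, S.τ₀ (S.τ₂ t)} := by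
    ext s
    simp [edge_eq_iff]
  have h1 := S.τ₀_ne t
  have h2 := S.τ₂_ne t
  have h3 := S.τ₀_τ₂_ne t
  have h4 : S.τ₀ t ≠ S.τ₂ t := fun h => h3 (by rw [← h, S.τ₀_invol])
  have h5 : S.τ₀ t ≠ S.τ₀ (S.τ₂ t) := fun h => h2 (by
    have := congrArg S.τ₀ h
    rwa [S.τ₀_invol, S.τ₀_invol, eq_comm] at this)
  have h6 := S.τ₀_ne (S.τ₂ t)
  rw [h, Finset.card_insert_of_notMem, Finset.card_insert_of_notMem,
    Finset.card_insert_of_notMem, Finset.card_singleton]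
  · simpa using h6.symm
  · simp [h4, h5]
  · simp [h1.symm, h2.symm, h3.symm]

theorem sum_edge [Fintype T] (g : S.Edge → ℝ) : ∑ t, g (S.edge t) = 4 * ∑ e, g e := by
  classical
  rw [← Finset.sum_fiberwise Finset.univ S.edge, Finset.mul_sum]
  refine Finset.sum_congr rfl fun e _ => ?_
  rw [Finset.sum_congr rfl (g := fun _ => g e)
    (fun t ht => by rw [(Finset.mem_filter.1 ht).2]), Finset.sum_const, card_edge_fiber]
  simp

theorem mem_edgesOf [Finite T] {X : Finset S.Face} {t : T} :
    S.edge t ∈ S.edgesOf X ↔ S.face t ∈ X ∨ S.face (S.τ₂ t) ∈ X := by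
  classical
  simp only [edgesOf, Finset.mem_filter, Finset.mem_univ, true_and, edge_eq_iff]
  constructor
  · rintro ⟨s, (rfl | rfl | rfl | rfl), hs⟩ <;> simp_all
  · rintro (h | h)
    · exact ⟨t, Or.inl rfl, h⟩
    · exact ⟨S.τ₂ t, by simp, h⟩

open Classical in
theorem sum_edgesOf [Fintype T] (g : S.Edge → ℝ) (X : Finset S.Face) :
    ∑ t, (if S.face t ∈ X ∨ S.face (S.τ₂ t) ∈ X then g (S.edge t) else 0) =
      4 * ∑ e ∈ S.edgesOf X, g e := by
  rw [Finset.sum_congr rfl fun t _ => if_congr S.mem_edgesOf.symm rfl rfl,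
    S.sum_edge (fun e => if e ∈ S.edgesOf X then g e else 0)]
  simp

/-! ### The cone angles as functions of the radii -/

open HypPlane

variable (D : S.Edge → ℝ)

/-- The angle at the centre in the triangle of the flag `t`, for radii `2 artanh x`. -/
def flagAngle (x : S.Face → ℝ) (t : T) : ℝ :=
  angleFun (Real.tan (D (S.edge t) / 2)) (x (S.face t)) (x (S.face (S.τ₂ t)))

open Classical in
/-- The cone angle at the centre of the face `f`, for radii `2 artanh x`. -/
def totalAngle [Fintype T] (x : S.Face → ℝ) (f : S.Face) : ℝ :=
  ∑ t ∈ Finset.univ.filter (fun t => S.face t = f), S.flagAngle D x t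

theorem flagAngle_τ₂ (x : S.Face → ℝ) (t : T) : S.flagAngle D x (S.τ₂ t) =
    angleFun (Real.tan (D (S.edge t) / 2)) (x (S.face (S.τ₂ t))) (x (S.face t)) := by
  rw [flagAngle, edge_τ₂, S.τ₂_invol]

open Classical in
/-- The contribution of the two triangles of the flags `t` and `τ₂ t` to the angles in `X`. -/
def pairAngle (x : S.Face → ℝ) (X : Finset S.Face) (t : T) : ℝ :=
  (if S.face t ∈ X then S.flagAngle D x t else 0) +
    if S.face (S.τ₂ t) ∈ X then S.flagAngle D x (S.τ₂ t) else 0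

/-- Reindexing by the involution `τ₂` brings together the two angles of one triangle, which is where
the estimates on `angleFun` apply. -/
theorem two_mul_sum_totalAngle [Fintype T] (x : S.Face → ℝ) (X : Finset S.Face) :
    2 * ∑ f ∈ X, S.totalAngle D x f = ∑ t, S.pairAngle D x X t := by
  classical
  have h1 : ∑ f ∈ X, S.totalAngle D x f =
      ∑ t, if S.face t ∈ X then S.flagAngle D x t else 0 := by
    rw [← Finset.sum_filter]
    simp only [totalAngle]
    rw [← Finset.sum_fiberwise_of_maps_to (s := Finset.univ.filter (fun t => S.face t ∈ X))
      (t := X) (g := S.face) (fun t ht => (Finset.mem_filter.1 ht).2)]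
    refine Finset.sum_congr rfl fun f hf => Finset.sum_congr ?_ fun _ _ => rfl
    ext t
    simp only [Finset.mem_filter, Finset.mem_univ, true_and]
    exact ⟨fun h => ⟨h ▸ hf, h⟩, fun h => h.2⟩
  have h2 : ∑ t, (if S.face (S.τ₂ t) ∈ X then S.flagAngle D x (S.τ₂ t) else 0) =
      ∑ t, if S.face t ∈ X then S.flagAngle D x t else 0 :=
    Equiv.sum_comp (Function.Involutive.toPerm S.τ₂ S.τ₂_invol)
      (fun t => if S.face t ∈ X then S.flagAngle D x t else 0)
  simp only [pairAngle, Finset.sum_add_distrib]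
  rw [h2, h1, two_mul]

variable {D}

theorem exists_face_mem {X : Finset S.Face} (hX : X.Nonempty) : ∃ t, S.face t ∈ X := by
  obtain ⟨f, hf⟩ := hX
  obtain ⟨t, rfl⟩ : ∃ t, S.face t = f := Quot.exists_rep f
  exact ⟨t, hf⟩

open Classical in
-- Either no angle of the triangle is counted, or one, or both; one angle and the sum of both are
-- each below `D`.
theorem pairAngle_le (hD : ∀ e, D e ∈ Set.Ioo 0 Real.pi) {x : S.Face → ℝ}
    (hx : ∀ f, x f ∈ Set.Ioo (0 : ℝ) 1) (X : Finset S.Face) (t : T) :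
    S.pairAngle D x X t ≤
      (if S.face t ∈ X ∨ S.face (S.τ₂ t) ∈ X then D (S.edge t) else 0) ∧
    (S.face t ∈ X → S.pairAngle D x X t <
      if S.face t ∈ X ∨ S.face (S.τ₂ t) ∈ X then D (S.edge t) else 0) := by
  have hT := tan_half_pos (hD (S.edge t))
  have hDe := two_arctan_tan_half (hD (S.edge t))
  rw [pairAngle, flagAngle_τ₂, flagAngle]
  have h1 := angleFun_add_swap_lt hT (hx (S.face t)).1 (hx (S.face (S.τ₂ t))).1
  have h2 := angleFun_lt hT (hx (S.face t)).1 (hx (S.face (S.τ₂ t)))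
  have h3 := angleFun_lt hT (hx (S.face (S.τ₂ t))).1 (hx (S.face t))
  rw [hDe] at h1 h2 h3
  by_cases ha : S.face t ∈ X <;> by_cases hb : S.face (S.τ₂ t) ∈ X <;> simp [ha, hb] <;>
    first | exact ⟨h1.le, h1⟩ | exact ⟨h2.le, h2⟩ | exact h3.le

theorem sum_totalAngle_lt [Fintype T] (hD : ∀ e, D e ∈ Set.Ioo 0 Real.pi) {x : S.Face → ℝ}
    (hx : ∀ f, x f ∈ Set.Ioo (0 : ℝ) 1) {X : Finset S.Face} (hX : X.Nonempty) :
    ∑ f ∈ X, S.totalAngle D x f / 2 < ∑ e ∈ S.edgesOf X, D e := by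
  classical
  obtain ⟨t, ht⟩ := S.exists_face_mem hX
  have h : ∑ t, S.pairAngle D x X t <
      ∑ t, if S.face t ∈ X ∨ S.face (S.τ₂ t) ∈ X then D (S.edge t) else 0 :=
    Finset.sum_lt_sum (fun s _ => (S.pairAngle_le hD hx X s).1)
      ⟨t, Finset.mem_univ t, (S.pairAngle_le hD hx X t).2 ht⟩
  rw [sum_edgesOf, ← two_mul_sum_totalAngle] at h
  rw [← Finset.sum_div]
  linarith

/-- Comparison on the set `X` where `x < x'`: passing to `x'` lowers the angles of every triangle
meeting `X`. Inside `X` the pair sum drops; across the boundary of `X` the own radius grows while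
the neighbour's does not. -/
theorem le_of_totalAngle_eq [Fintype T] (hD : ∀ e, D e ∈ Set.Ioo 0 Real.pi) {x x' : S.Face → ℝ}
    (hx : ∀ f, x f ∈ Set.Ioo (0 : ℝ) 1) (hx' : ∀ f, x' f ∈ Set.Ioo (0 : ℝ) 1)
    (h : ∀ f, S.totalAngle D x f = S.totalAngle D x' f) (f : S.Face) : x' f ≤ x f := by
  classical
  by_contra! hf
  let X : Finset S.Face := Finset.univ.filter (fun f => x f < x' f)
  have hX : ∀ f, f ∈ X ↔ x f < x' f := fun f => by simp [X]
  have key : ∀ t, S.pairAngle D x' X t ≤ S.pairAngle D x X t ∧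
      (S.face t ∈ X → S.pairAngle D x' X t < S.pairAngle D x X t) := by
    intro t
    have hT := tan_half_pos (hD (S.edge t))
    have mono : ∀ a b, a ∈ X → b ∉ X →
        angleFun (Real.tan (D (S.edge t) / 2)) (x' a) (x' b) <
          angleFun (Real.tan (D (S.edge t) / 2)) (x a) (x b) := by
      intro a b ha hb
      exact (angleFun_strictAnti_left hT (hx a).1 ((hX a).1 ha) (hx' b).1).trans_le
        (angleFun_monotone_right hT (hx a) (hx' b).1 (not_lt.1 fun h => hb ((hX b).2 h)) (hx b).2)
    simp only [pairAngle, flagAngle_τ₂]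
    simp only [flagAngle]
    by_cases ha : S.face t ∈ X <;> by_cases hb : S.face (S.τ₂ t) ∈ X
    · have := angleFun_add_swap_strictAnti hT (hx _).1 (hx _).1 ((hX _).1 ha) ((hX _).1 hb)
      simp only [ha, hb, if_true]
      exact ⟨this.le, fun _ => this⟩
    · have := mono _ _ ha hb
      simp only [ha, hb, if_true, if_false, add_zero]
      exact ⟨this.le, fun _ => this⟩
    · have := mono _ _ hb ha
      simp only [ha, hb, if_true, if_false, zero_add]
      exact ⟨this.le, fun h => h.elim⟩
    · simp [ha, hb]
  obtain ⟨t, ht⟩ := S.exists_face_mem ⟨f, (hX f).2 hf⟩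
  have hlt : ∑ t, S.pairAngle D x' X t < ∑ t, S.pairAngle D x X t :=
    Finset.sum_lt_sum (fun s _ => (key s).1) ⟨t, Finset.mem_univ t, (key t).2 ht⟩
  rw [← two_mul_sum_totalAngle, ← two_mul_sum_totalAngle, Finset.sum_congr rfl fun f _ => h f]
    at hlt
  exact lt_irrefl _ hlt

/-! ### Existence of radii with prescribed cone angles -/

theorem continuousAt_flagAngle {x : S.Face → ℝ} {t : T} (h0 : ∀ f, 0 ≤ x f)
    (h : 0 < x (S.face t) + x (S.face (S.τ₂ t))) :
    ContinuousAt (fun x => S.flagAngle D x t) x :=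
  (continuousAt_angleFun (h0 _) (h0 _) h).comp
    (f := fun x : S.Face → ℝ => (x (S.face t), x (S.face (S.τ₂ t))))
    (by fun_prop)

theorem continuousAt_totalAngle [Fintype T] {x : S.Face → ℝ} (h0 : ∀ f, 0 < x f) (f : S.Face) :
    ContinuousAt (fun x => S.totalAngle D x f) x := by
  unfold totalAngle
  exact tendsto_finsetSum _ fun t _ =>
    S.continuousAt_flagAngle (fun f => (h0 f).le) (add_pos (h0 _) (h0 _))

/-- Radii for which the cone angles are not larger than prescribed. -/
def superRadii [Fintype T] (D : S.Edge → ℝ) (Φ : S.Face → ℝ) : Set (S.Face → ℝ) :=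
  {x | (∀ f, x f ∈ Set.Ioo (0 : ℝ) 1) ∧ ∀ f, S.totalAngle D x f ≤ Φ f}

/-- Only neighbouring radii grow. An edge with `f` on both sides causes no trouble, since its angle
then depends on `x f` alone. -/
theorem totalAngle_mono [Fintype T] (hD : ∀ e, D e ∈ Set.Ioo 0 Real.pi) {x x' : S.Face → ℝ}
    (hx : ∀ f, x f ∈ Set.Ioo (0 : ℝ) 1) (hx' : ∀ f, x' f ∈ Set.Ioo (0 : ℝ) 1) {f : S.Face}
    (hf : x f = x' f) (hle : ∀ g, x g ≤ x' g) : S.totalAngle D x f ≤ S.totalAngle D x' f := by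
  classical
  refine Finset.sum_le_sum fun t ht => ?_
  have ht : S.face t = f := (Finset.mem_filter.1 ht).2
  rw [flagAngle, flagAngle, ht, ← hf]
  exact angleFun_monotone_right (tan_half_pos (hD _)) (hx f) (hx _).1 (hle _) (hx' _).2

/-- At each face the minimum agrees with one of the two functions and lies below it elsewhere, so
the cone angle there only drops. -/
theorem inf_mem_superRadii [Fintype T] (hD : ∀ e, D e ∈ Set.Ioo 0 Real.pi) {Φ : S.Face → ℝ}
    {x y : S.Face → ℝ} (hx : x ∈ S.superRadii D Φ) (hy : y ∈ S.superRadii D Φ) :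
    x ⊓ y ∈ S.superRadii D Φ := by
  have h0 : ∀ f, (x ⊓ y) f ∈ Set.Ioo (0 : ℝ) 1 := fun f =>
    ⟨lt_min (hx.1 f).1 (hy.1 f).1, (min_le_left _ _).trans_lt (hx.1 f).2⟩
  refine ⟨h0, fun f => ?_⟩
  rcases le_total (x f) (y f) with h | h
  · exact (S.totalAngle_mono hD h0 hx.1 (min_eq_left h) fun g => min_le_left _ _).trans (hx.2 f)
  · exact (S.totalAngle_mono hD h0 hy.1 (min_eq_right h) fun g => min_le_right _ _).trans (hy.2 f)

open Filter Topology

/-- Constant radii tending to infinity, that is `x → 1`, make all angles tend to `0`. -/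
theorem superRadii_nonempty [Fintype T] {Φ : S.Face → ℝ} (hΦ : ∀ f, 0 < Φ f) :
    (S.superRadii D Φ).Nonempty := by
  have hc : ∀ f, Tendsto (fun s : ℝ => S.totalAngle D (fun _ => s) f) (𝓝[<] 1) (𝓝 0) := by
    intro f
    have h1 : ContinuousAt (fun s : ℝ => S.totalAngle D (fun _ => s) f) 1 :=
      (S.continuousAt_totalAngle (D := D) (x := fun _ => 1) (fun _ => one_pos) f).comp
        (f := fun (s : ℝ) (_ : S.Face) => s) (by fun_prop)
    have h2 : S.totalAngle D (fun _ => 1) f = 0 := by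
      simp [totalAngle, flagAngle, angleFun]
    have h3 := h1.tendsto
    rw [h2] at h3
    exact h3.mono_left nhdsWithin_le_nhds
  have h4 : ∀ᶠ s : ℝ in 𝓝[<] 1, ∀ f, S.totalAngle D (fun _ => s) f < Φ f :=
    eventually_all.2 fun f => (hc f).eventually_lt_const (hΦ f)
  have h5 : ∀ᶠ s : ℝ in 𝓝[<] 1, s ∈ Set.Ioo (0 : ℝ) 1 := Ioo_mem_nhdsLT one_pos
  obtain ⟨s, hs, hs'⟩ := (h4.and h5).exists
  exact ⟨fun _ => s, fun _ => hs', fun f => (hs f).le⟩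

open Classical in
-- Degeneration when exactly the radii in `X` shrink to zero. If both radii vanish, the single
-- angles need not converge, but their sum tends to `D` because it depends only on the product `xy`.
theorem tendsto_pairAngle (hD : ∀ e, D e ∈ Set.Ioo 0 Real.pi) {x : S.Face → ℝ}
    {u : ℕ → S.Face → ℝ} (hu : Tendsto u atTop (𝓝 x)) (hx : ∀ f, 0 ≤ x f)
    {X : Finset S.Face} (hX : ∀ f, f ∈ X ↔ x f = 0) (t : T) :
    Tendsto (fun n => S.pairAngle D (u n) X t) atTop
      (𝓝 (if S.face t ∈ X ∨ S.face (S.τ₂ t) ∈ X then D (S.edge t) else 0)) := by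
  have hpos : ∀ f, f ∉ X → 0 < x f := fun f hf =>
    lt_of_le_of_ne (hx f) fun h => hf ((hX f).2 h.symm)
  have hu' : ∀ f, Tendsto (fun n => u n f) atTop (𝓝 (x f)) := tendsto_pi_nhds.1 hu
  have hDe := two_arctan_tan_half (hD (S.edge t))
  have hone : ∀ a b, a ∈ X → b ∉ X → Tendsto
      (fun n => angleFun (Real.tan (D (S.edge t) / 2)) (u n a) (u n b)) atTop
        (𝓝 (D (S.edge t))) := by
    intro a b ha hb
    have h1 := hpos b hb
    have h2 := (continuousAt_angleFun (T := Real.tan (D (S.edge t) / 2)) (hx a) (hx b)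
      (add_pos_of_nonneg_of_pos (hx a) h1)).tendsto.comp ((hu' a).prodMk_nhds (hu' b))
    have h3 : angleFun (Real.tan (D (S.edge t) / 2)) (x a) (x b) = D (S.edge t) := by
      rw [(hX a).1 ha, angleFun, zero_mul, sub_zero, add_zero, mul_one, div_one, sub_zero, zero_add,
        mul_div_cancel_right₀ _ h1.ne', ← two_mul, hDe]
    dsimp only at h2
    rw [h3] at h2
    exact h2
  simp only [pairAngle, flagAngle_τ₂]
  simp only [flagAngle]
  by_cases ha : S.face t ∈ X <;> by_cases hb : S.face (S.τ₂ t) ∈ X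
  · simp only [ha, hb, if_true, true_or, angleFun_add_swap]
    have h1 : ContinuousAt (fun z : ℝ => 2 * Real.arctan
        (Real.tan (D (S.edge t) / 2) * (1 - z) / (1 + z))) 0 :=
      (Real.continuous_arctan.continuousAt.comp
        (ContinuousAt.div (by fun_prop) (by fun_prop) (by simp))).const_mul 2
    have h2 := (hu' (S.face t)).mul (hu' (S.face (S.τ₂ t)))
    rw [(hX _).1 ha, zero_mul] at h2
    have h3 := h1.tendsto.comp h2
    simp only [sub_zero, add_zero, mul_one, div_one, hDe] at h3
    exact h3
  · simpa only [ha, hb, if_true, if_false, true_or, add_zero] using hone _ _ ha hb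
  · simpa only [ha, hb, if_true, if_false, or_true, zero_add] using hone _ _ hb ha
  · simp [ha, hb]

theorem exists_totalAngle_eq [Fintype T] (hD : ∀ e, D e ∈ Set.Ioo 0 Real.pi) {Φ : S.Face → ℝ}
    (hΦ : ∀ f, 0 < Φ f)
    (h : ∀ X : Finset S.Face, X.Nonempty → ∑ f ∈ X, Φ f / 2 < ∑ e ∈ S.edgesOf X, D e) :
    ∃ x : S.Face → ℝ, (∀ f, x f ∈ Set.Ioo (0 : ℝ) 1) ∧ ∀ f, S.totalAngle D x f = Φ f := by
  classical
  let B := S.superRadii D Φ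
  obtain ⟨b, hb⟩ : B.Nonempty := S.superRadii_nonempty hΦ
  let x : S.Face → ℝ := fun f => sInf ((fun y : S.Face → ℝ => y f) '' B)
  have hbdd : ∀ f, BddBelow ((fun y : S.Face → ℝ => y f) '' B) := fun f =>
    ⟨0, by rintro _ ⟨y, hy, rfl⟩; exact (hy.1 f).1.le⟩
  have hxle : ∀ y ∈ B, ∀ f, x f ≤ y f := fun y hy f => csInf_le (hbdd f) ⟨y, hy, rfl⟩
  have hx0 : ∀ f, 0 ≤ x f := fun f =>
    le_csInf ⟨b f, b, hb, rfl⟩ (by rintro _ ⟨y, hy, rfl⟩; exact (hy.1 f).1.le)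
  have hx1 : ∀ f, x f < 1 := fun f => (hxle b hb f).trans_lt (hb.1 f).2
  -- Closure under minima gives one member of the family close to the infimum at all faces
  -- simultaneously.
  have happrox : ∀ ε > 0, ∀ s : Finset S.Face, ∃ y ∈ B, ∀ f ∈ s, y f < x f + ε := by
    intro ε hε s
    induction s using Finset.induction_on with
    | empty => exact ⟨b, hb, by simp⟩
    | insert f s _ ih =>
      obtain ⟨y, hy, hys⟩ := ih
      obtain ⟨_, ⟨z, hz, rfl⟩, hzf⟩ := exists_lt_of_csInf_lt
        (s := (fun y : S.Face → ℝ => y f) '' B) ⟨b f, b, hb, rfl⟩ (lt_add_of_pos_right (x f) hε)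
      refine ⟨y ⊓ z, S.inf_mem_superRadii hD hy hz, fun g hg => ?_⟩
      rcases Finset.mem_insert.1 hg with rfl | hg
      · exact (min_le_right _ _).trans_lt hzf
      · exact (min_le_left _ _).trans_lt (hys g hg)
  choose u huB hu using fun n : ℕ => happrox (1 / ((n : ℝ) + 1)) (by positivity) Finset.univ
  have hlim : Tendsto u atTop (𝓝 x) := by
    refine tendsto_pi_nhds.2 fun f => tendsto_of_tendsto_of_tendsto_of_le_of_le
      tendsto_const_nhds (g := fun _ => x f) (h := fun n : ℕ => x f + 1 / ((n : ℝ) + 1)) ?_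
      (fun n => hxle _ (huB n) f) (fun n => (hu n f (Finset.mem_univ f)).le)
    simpa using tendsto_one_div_add_atTop_nhds_zero_nat.const_add (x f)
  have hxpos : ∀ f, 0 < x f := by
    let X : Finset S.Face := Finset.univ.filter (fun f => x f = 0)
    have hX : ∀ f, f ∈ X ↔ x f = 0 := fun f => by simp [X]
    by_contra! hneg
    obtain ⟨f, hf⟩ := hneg
    have hXne : X.Nonempty := ⟨f, (hX f).2 (le_antisymm hf (hx0 f))⟩
    have h1 := tendsto_finsetSum (Finset.univ : Finset T)
      fun t _ => S.tendsto_pairAngle hD hlim hx0 hX t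
    rw [S.sum_edgesOf] at h1
    have h2 : 4 * ∑ e ∈ S.edgesOf X, D e ≤ 2 * ∑ f ∈ X, Φ f := by
      refine le_of_tendsto' h1 fun n => ?_
      rw [← two_mul_sum_totalAngle]
      gcongr with f
      exact (huB n).2 f
    have h3 := h X hXne
    rw [← Finset.sum_div] at h3
    linarith
  have hxB : x ∈ B := ⟨fun f => ⟨hxpos f, hx1 f⟩, fun f =>
    le_of_tendsto' ((S.continuousAt_totalAngle hxpos f).tendsto.comp hlim) fun n => (huB n).2 f⟩
  refine ⟨x, hxB.1, fun f => le_antisymm (hxB.2 f) (not_lt.1 fun hlt => ?_)⟩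
  -- If the cone angle at `f` is too small, lowering `x f` slightly keeps it below `Φ f` and raises
  -- no other cone angle. The new radii stay in the family, below its infimum at `f`.
  have hcont : ContinuousAt (fun s : ℝ => S.totalAngle D (Function.update x f s) f) (x f) := by
    refine ContinuousAt.comp (g := fun x => S.totalAngle D x f)
      (f := fun s : ℝ => Function.update x f s) ?_ ?_
    · rw [Function.update_eq_self]
      exact S.continuousAt_totalAngle hxpos f
    · exact (continuous_const.update f continuous_id).continuousAt
  have h1 : ∀ᶠ s in 𝓝[<] (x f), S.totalAngle D (Function.update x f s) f < Φ f := by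
    refine (hcont.tendsto.mono_left nhdsWithin_le_nhds).eventually_lt_const ?_
    rwa [Function.update_eq_self]
  obtain ⟨s, hs, hs0, hsx⟩ :=
    (h1.and (Ioo_mem_nhdsLT (hxpos f) : ∀ᶠ s in 𝓝[<] (x f), s ∈ Set.Ioo 0 (x f))).exists
  have hle : ∀ g, Function.update x f s g ≤ x g := by
    intro g
    rcases eq_or_ne g f with rfl | hg
    · rw [Function.update_self]
      exact hsx.le
    · rw [Function.update_of_ne hg]
  have hmem : ∀ g, Function.update x f s g ∈ Set.Ioo (0 : ℝ) 1 := by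
    refine fun g => ⟨?_, (hle g).trans_lt (hx1 g)⟩
    rcases eq_or_ne g f with rfl | hg
    · rwa [Function.update_self]
    · rw [Function.update_of_ne hg]
      exact hxpos g
  have hupd : Function.update x f s ∈ B := by
    refine ⟨hmem, fun g => ?_⟩
    rcases eq_or_ne g f with rfl | hg
    · exact hs.le
    · exact (S.totalAngle_mono hD hmem hxB.1 (Function.update_of_ne hg _ _) hle).trans (hxB.2 g)
  have := hxle _ hupd f
  rw [Function.update_self] at this
  linarith

end CellSurface


namespace HypCirclePattern

open HypPlane

variable {T : Type*} {S : CellSurface T} {D D' : S.Edge → ℝ}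

/-! ### Patterns and their radii -/

section Radii

variable (C : HypCirclePattern S D)

theorem dist_O_τ₂_P (t : T) : dist (C.O (S.τ₂ t)) (C.P t) = C.radius (S.face (S.τ₂ t)) := by
  rw [← C.dist_eq (S.τ₂ t), C.P_τ₂]

theorem phi_eq (hD : ∀ e, D e ∈ Set.Ioo 0 Real.pi) (t : T) :
    C.phi t = S.flagAngle D (fun f => Real.tanh (C.radius f / 2)) t := by
  have h1 : 0 < dist (C.O t) (C.P t) := by
    rw [C.dist_eq]
    exact C.radius_pos _
  have h2 : 0 < dist (C.O (S.τ₂ t)) (C.P t) := by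
    rw [C.dist_O_τ₂_P]
    exact C.radius_pos _
  rw [phi, angle_eq_angleFun (hD _) (C.angle_eq t) h1 h2, C.dist_eq, C.dist_O_τ₂_P]
  rfl

theorem coneAngle_eq [Fintype T] (hD : ∀ e, D e ∈ Set.Ioo 0 Real.pi) (f : S.Face) :
    C.coneAngle f = S.totalAngle D (fun f => Real.tanh (C.radius f / 2)) f :=
  Finset.sum_congr rfl fun t _ => C.phi_eq hD t

end Radii

theorem radius_eq_of_coneAngle_eq [Fintype T] (hD : ∀ e, D e ∈ Set.Ioo 0 Real.pi)
    (C C' : HypCirclePattern S D) (h : ∀ f, C.coneAngle f = C'.coneAngle f) (f : S.Face) :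
    C'.radius f = C.radius f := by
  have hx := fun f => tanh_half_mem (C.radius_pos f)
  have hx' := fun f => tanh_half_mem (C'.radius_pos f)
  have h1 : ∀ f, S.totalAngle D (fun f => Real.tanh (C.radius f / 2)) f =
      S.totalAngle D (fun f => Real.tanh (C'.radius f / 2)) f := fun f => by
    rw [← coneAngle_eq C hD, ← coneAngle_eq C' hD, h]
  have h2 := Real.tanh_injective (le_antisymm (S.le_of_totalAngle_eq hD hx hx' h1 f)
    (S.le_of_totalAngle_eq hD hx' hx (fun f => (h1 f).symm) f))
  linarith

/-- A pattern exists for any radii. -/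
theorem exists_radius_eq (hD : ∀ e, D e ∈ Set.Ioo 0 Real.pi) (r : S.Face → ℝ)
    (hr : ∀ f, 0 < r f) : ∃ C : HypCirclePattern S D, C.radius = r := by
  classical
  have hrep : ∀ e : S.Edge, ∃ t, S.edge t = e := Quot.exists_rep
  -- One flag `k e` per edge fixes which corner of the kite is which; the other three flags of `e`
  -- are its images under `τ₀`, `τ₂` and both.
  choose k hk using hrep
  choose o a p q hop hoq hap haq hp hq hqp using fun e : S.Edge =>
    exists_kite (hr (S.face (k e))) (hr (S.face (S.τ₂ (k e)))) (hD e)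
  let O : T → UpperHalfPlane := fun t =>
    if t = k (S.edge t) ∨ t = S.τ₀ (k (S.edge t)) then o (S.edge t) else a (S.edge t)
  let P : T → UpperHalfPlane := fun t =>
    if t = k (S.edge t) ∨ t = S.τ₂ (k (S.edge t)) then p (S.edge t) else q (S.edge t)
  have n1 : ∀ t, S.τ₂ t ≠ S.τ₀ t := fun t h => S.τ₀_τ₂_ne t (by rw [h, S.τ₀_invol])
  have n2 : ∀ t, S.τ₀ (S.τ₂ t) ≠ S.τ₀ t := fun t h => S.τ₂_ne t (by
    have := congrArg S.τ₀ h
    rwa [S.τ₀_invol, S.τ₀_invol] at this)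
  have O1 : ∀ e, O (k e) = o e := fun e => by simp [O, hk]
  have O2 : ∀ e, O (S.τ₀ (k e)) = o e := fun e => by simp [O, hk]
  have O3 : ∀ e, O (S.τ₂ (k e)) = a e := fun e => by simp [O, hk, S.τ₂_ne, n1]
  have O4 : ∀ e, O (S.τ₀ (S.τ₂ (k e))) = a e := fun e => by
    simp [O, hk, S.τ₀_τ₂_ne, n2]
  have P1 : ∀ e, P (k e) = p e := fun e => by simp [P, hk]
  have P2 : ∀ e, P (S.τ₂ (k e)) = p e := fun e => by simp [P, hk]
  have P3 : ∀ e, P (S.τ₀ (k e)) = q e := fun e => by simp [P, hk, S.τ₀_ne, (n1 _).symm]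
  have P4 : ∀ e, P (S.τ₀ (S.τ₂ (k e))) = q e := fun e => by
    simp [P, hk, S.τ₀_τ₂_ne, S.τ₀_ne]
  have cases : ∀ {motive : T → Prop}, (∀ e, motive (k e) ∧ motive (S.τ₀ (k e)) ∧
      motive (S.τ₂ (k e)) ∧ motive (S.τ₀ (S.τ₂ (k e)))) → ∀ t, motive t := by
    intro motive h t
    obtain ⟨h1, h2, h3, h4⟩ := h (S.edge t)
    rcases S.edge_eq_iff.1 (hk (S.edge t)).symm with ht | ht | ht | ht <;> rw [ht] <;> assumption
  refine ⟨{
    radius := r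
    radius_pos := hr
    O := O
    P := P
    O_τ₀ := cases fun e => by simp only [O1, O2, O3, O4, S.τ₀_invol, and_self]
    P_τ₂ := cases fun e => by
      simp only [P1, P2, P3, P4, S.τ₂_invol, ← S.τ₀_τ₂_comm, and_self]
    P_ne := cases fun e => by
      simp only [P1, P2, P3, P4, S.τ₀_invol]
      exact ⟨hqp e, (hqp e).symm, hqp e, (hqp e).symm⟩
    dist_eq := cases fun e => by
      simp only [O1, O2, O3, O4, P1, P2, P3, P4, S.face_τ₀]
      exact ⟨hop e, hoq e, hap e, haq e⟩
    angle_eq := cases fun e => by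
      simp only [O1, O2, O3, O4, P1, P2, P3, P4, S.edge_τ₀, S.edge_τ₂, S.τ₂_invol,
        ← S.τ₀_τ₂_comm, hk]
      exact ⟨hp e, hq e, (angle_comm _ _ _).trans (hp e), (angle_comm _ _ _).trans (hq e)⟩ }, rfl⟩

/-! ### Isometries of patterns -/

/-- Isometries of the hyperbolic plane, one for each edge, taking the quadrilaterals of `C` to
those of `C'`. -/
structure EdgeCongruence (C : HypCirclePattern S D) (C' : HypCirclePattern S D') where
  iso : S.Edge → UpperHalfPlane ≃ᵢ UpperHalfPlane
  iso_O : ∀ t, iso (S.edge t) (C.O t) = C'.O t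
  iso_P : ∀ t, iso (S.edge t) (C.P t) = C'.P t

/-- Radii and `D` fix `|OO'|` by the law of cosines, so the kites agree in all sides; `P_ne`
excludes the folded kite with `Q = P`. -/
theorem exists_edgeCongruence (hD : ∀ e, D e ∈ Set.Ioo 0 Real.pi) (C C' : HypCirclePattern S D)
    (hr : ∀ f, C'.radius f = C.radius f) : Nonempty (EdgeCongruence C C') := by
  have dist_P_τ₀ : ∀ (C : HypCirclePattern S D) t,
      dist (C.O t) (C.P (S.τ₀ t)) = C.radius (S.face t) := fun C t => by
    rw [← C.O_τ₀, C.dist_eq, S.face_τ₀]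
  have dist_τ₂_P_τ₀ : ∀ (C : HypCirclePattern S D) t,
      dist (C.O (S.τ₂ t)) (C.P (S.τ₀ t)) = C.radius (S.face (S.τ₂ t)) := fun C t => by
    rw [← dist_P_τ₀, S.τ₀_τ₂_comm, C.P_τ₂]
  have key : ∀ e : S.Edge, ∃ g : UpperHalfPlane ≃ᵢ UpperHalfPlane, ∀ t, S.edge t = e →
      g (C.O t) = C'.O t ∧ g (C.P t) = C'.P t := by
    intro e
    obtain ⟨t, rfl⟩ : ∃ t, S.edge t = e := Quot.exists_rep e
    have hne : C.O t ≠ C.O (S.τ₂ t) := ne_of_angle (hD _) (C.angle_eq t)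
      (by rw [C.dist_eq]; exact C.radius_pos _) (by rw [C.dist_O_τ₂_P]; exact C.radius_pos _)
    have hOO : dist (C.O t) (C.O (S.τ₂ t)) = dist (C'.O t) (C'.O (S.τ₂ t)) := by
      refine dist_eq_of_cosh_eq dist_nonneg ?_
      rw [cosh_dist_of_angle (C.angle_eq t), cosh_dist_of_angle (C'.angle_eq t), C.dist_eq,
        C'.dist_eq, C.dist_O_τ₂_P, C'.dist_O_τ₂_P, hr, hr]
    obtain ⟨g, h1, h2, h3, h4⟩ := exists_isometry_of_kite (p := C.P t) (q := C.P (S.τ₀ t))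
      (p₁ := C'.P t) (q₁ := C'.P (S.τ₀ t)) hne hOO (by rw [C.dist_eq, C'.dist_eq, hr])
      (by rw [C.dist_O_τ₂_P, C'.dist_O_τ₂_P, hr]) (by rw [dist_P_τ₀, C.dist_eq])
      (by rw [dist_τ₂_P_τ₀, C.dist_O_τ₂_P]) (by rw [dist_P_τ₀, C'.dist_eq])
      (by rw [dist_τ₂_P_τ₀, C'.dist_O_τ₂_P]) (C.P_ne t) (C'.P_ne t)
    refine ⟨g, fun s hs => ?_⟩
    rcases S.edge_eq_iff.1 hs with rfl | rfl | rfl | rfl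
    · exact ⟨h1, h3⟩
    · exact ⟨by rw [C.O_τ₀, C'.O_τ₀, h1], h4⟩
    · exact ⟨h2, by rw [C.P_τ₂, C'.P_τ₂, h3]⟩
    · exact ⟨by rw [C.O_τ₀, C'.O_τ₀, h2],
        by rw [S.τ₀_τ₂_comm, C.P_τ₂, C'.P_τ₂, h4]⟩
  choose g hg using key
  exact ⟨⟨g, fun t => (hg _ t rfl).1, fun t => (hg _ t rfl).2⟩⟩

theorem map_mem_segment (g : UpperHalfPlane ≃ᵢ UpperHalfPlane) {a b x : UpperHalfPlane}
    (hx : x ∈ segment a b) : g x ∈ segment (g a) (g b) := by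
  simpa only [HypPlane.segment, Set.mem_ofPred_eq, g.dist_eq] using hx

theorem map_mem_triangle (g : UpperHalfPlane ≃ᵢ UpperHalfPlane) {p a b x : UpperHalfPlane}
    (hx : x ∈ triangle p a b) : g x ∈ triangle (g p) (g a) (g b) := by
  obtain ⟨y, hy, hxy⟩ := hx
  exact ⟨g y, map_mem_segment g hy, map_mem_segment g hxy⟩

namespace EdgeCongruence

variable {C : HypCirclePattern S D} {C' : HypCirclePattern S D'} (K : EdgeCongruence C C')

/-- The inverse congruence. -/
def symm : EdgeCongruence C' C where
  iso e := (K.iso e).symm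
  iso_O t := by rw [← K.iso_O, IsometryEquiv.symm_apply_apply]
  iso_P t := by rw [← K.iso_P, IsometryEquiv.symm_apply_apply]

theorem map_mem_region {t : T} {x : UpperHalfPlane} (hx : x ∈ C.region t) :
    K.iso (S.edge t) x ∈ C'.region t := by
  have h := map_mem_triangle (K.iso (S.edge t)) hx
  have h2 := K.iso_O (S.τ₂ t)
  rw [S.edge_τ₂] at h2
  rwa [K.iso_O, K.iso_P, h2] at h

/-- The map of the quadrilaterals. -/
def mapPieces (x : C.Pieces) : C'.Pieces :=
  ⟨(x.1.1, K.iso x.1.1 x.1.2), by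
    obtain ⟨t, ht, hx⟩ := x.2
    exact ⟨t, ht, ht ▸ K.map_mem_region hx⟩⟩

theorem glue_mapPieces {x y : C.Pieces} (h : C.Glue x y) :
    C'.Glue (K.mapPieces x) (K.mapPieces y) := by
  obtain ⟨t, _, _, hx, hx', hy, hy', hd⟩ := h
  refine ⟨t, _, _, hx, ?_, hy, ?_, ?_⟩
  · have := map_mem_segment (K.iso (S.edge t)) hx'
    rw [K.iso_O, K.iso_P] at this
    simpa only [mapPieces, hx] using this
  · have := map_mem_segment (K.iso (S.edge (S.τ₁ t))) hy'
    rw [K.iso_O, K.iso_P] at this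
    simpa only [mapPieces, hy] using this
  · rw [← K.iso_O, ← K.iso_O]
    simpa only [mapPieces, hx, hy, IsometryEquiv.dist_eq] using hd

/-- The map of the surfaces. -/
def map : C.Surface → C'.Surface :=
  Quot.map K.mapPieces fun _ _ => K.glue_mapPieces

theorem map_pt (t : T) (x : UpperHalfPlane) (hx : x ∈ C.region t) :
    K.map (C.pt t x hx) = C'.pt t (K.iso (S.edge t) x) (K.map_mem_region hx) := rfl

theorem symm_map_map (x : C.Surface) : K.symm.map (K.map x) = x := by
  induction x using Quot.ind with
  | mk x =>
    refine congrArg (Quot.mk C.Glue) (Subtype.ext (Prod.ext rfl ?_))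
    exact (K.iso x.1.1).symm_apply_apply x.1.2

/-- The map of the surfaces, as an equivalence. -/
def equiv : C.Surface ≃ C'.Surface where
  toFun := K.map
  invFun := K.symm.map
  left_inv := K.symm_map_map
  right_inv := K.symm.symm_map_map

theorem isChain_map {x y : C.Surface} {L : NNReal} (h : C.IsChain x y L) :
    C'.IsChain (K.map x) (K.map y) L := by
  induction h with
  | nil => exact .nil _
  | snoc t y z hy hz L _ ih =>
    have := IsChain.snoc (C := C') (K.map x) t _ _ (K.map_mem_region hy) (K.map_mem_region hz) L ih
    rwa [(K.iso (S.edge t)).isometry.nndist_eq] at this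

theorem surfDist_map_le (x y : C.Surface) : C'.surfDist (K.map x) (K.map y) ≤ C.surfDist x y :=
  le_iInf₂ fun L hL => iInf₂_le L (K.isChain_map hL)

/-- Chains go to chains of equal length, so neither the map nor its inverse increases distances. -/
theorem surfDist_map (x y : C.Surface) : C'.surfDist (K.map x) (K.map y) = C.surfDist x y := by
  refine le_antisymm (K.surfDist_map_le x y) ?_
  have := K.symm.surfDist_map_le (K.map x) (K.map y)
  rwa [K.symm_map_map, K.symm_map_map] at this

theorem map_mem_cell {t : T} {x : C.Surface} (hx : x ∈ C.cell t) : K.map x ∈ C'.cell t := by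
  obtain ⟨z, hz, rfl⟩ := hx
  exact ⟨_, K.map_mem_region hz, rfl⟩

theorem image_cell (t : T) : K.map '' C.cell t = C'.cell t := by
  refine Set.Subset.antisymm (Set.image_subset_iff.2 fun x => K.map_mem_cell) fun y hy => ?_
  exact ⟨K.symm.map y, K.symm.map_mem_cell hy, K.symm.symm_map_map y⟩

theorem isometric (K : EdgeCongruence C C') (hr : ∀ f, C'.radius f = C.radius f) : C.Isometric C' := by
  refine ⟨hr, K.equiv, K.surfDist_map, K.image_cell, fun t => ?_, fun t => ?_⟩
  · exact (K.map_pt t _ (C.O_mem t)).trans (by simp only [K.iso_O])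
  · exact (K.map_pt t _ (C.P_mem t)).trans (by simp only [K.iso_P])

end EdgeCongruence

end HypCirclePattern

end

theorem mainTheorem1 {T : Type*} [Fintype T] (S : CellSurface T)
    (D : S.Edge → ℝ) (hD : ∀ e, D e ∈ Set.Ioo 0 Real.pi)
    (Φ : S.Face → ℝ) (hΦ : ∀ f, 0 < Φ f) :
    ((∃ C : HypCirclePattern S D, ∀ f, C.coneAngle f = Φ f) ↔
      ∀ X : Finset S.Face, X.Nonempty →
        ∑ f ∈ X, Φ f / 2 < ∑ e ∈ S.edgesOf X, D e) ∧
    (∀ C C' : HypCirclePattern S D,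
      (∀ f, C.coneAngle f = Φ f) → (∀ f, C'.coneAngle f = Φ f) → C.Isometric C') := by
  refine ⟨⟨?_, fun h => ?_⟩, fun C C' hC hC' => ?_⟩
  · rintro ⟨C, hC⟩ X hX
    have h := S.sum_totalAngle_lt hD (fun f => HypPlane.tanh_half_mem (C.radius_pos f)) hX
    simpa only [← C.coneAngle_eq hD, hC] using h
  · obtain ⟨x, hx, hxΦ⟩ := S.exists_totalAngle_eq hD hΦ h
    -- The radius `2 artanh x` inverts the substitution `x = tanh (r/2)`.
    obtain ⟨C, hC⟩ := HypCirclePattern.exists_radius_eq hD (fun f => 2 * Real.artanh (x f))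
      fun f => mul_pos two_pos (Real.artanh_pos (hx f))
    refine ⟨C, fun f => ?_⟩
    have hx' : (fun f => Real.tanh (C.radius f / 2)) = x := by
      funext g
      rw [hC, mul_div_cancel_left₀ _ two_ne_zero,
        Real.tanh_artanh ⟨by linarith [(hx g).1], (hx g).2⟩]
    rw [C.coneAngle_eq hD, hx', hxΦ]
  · have hr := HypCirclePattern.radius_eq_of_coneAngle_eq hD C C' fun f => by rw [hC, hC']
    obtain ⟨K⟩ := HypCirclePattern.exists_edgeCongruence hD C C' hr
    exact K.isometric hr
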